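/- An ABA framework is a tuple $\mathcal F=\langle\mathcal L,\mathcal R,\mathcal A,\overline{\phantom{x}}\rangle$, where $\mathcal L$ is a set of sentences, $\mathcal R$ is a set of rules $\varphi_0\leftarrow\varphi_1,\dots,\varphi_m$ ($m\ge 0$, $\varphi_i\in\mathcal L$), $\mathcal A\subseteq\mathcal L$ is a non-empty set of assumptions, and $\overline{\phantom{x}}:\mathcal A\to\mathcal L$ is a total map, $\overline{\alpha}$ being the contrary of $\alpha$. A deduction $A\vdash^R\varphi$ is a finite tree with root labelled $\varphi$, in which every leaf is labelled by an assumption or stands for an empty rule body, $A$ being the set of all assumptions labelling leaves, and in which the children of every other node, labelled $\psi$ say, are labelled by the elements of the body of some rule in $\mathcal R$ with head $\psi$, $R$ being the set of all rules so used. The framework is bipolar if every rule has the form $\varphi\leftarrow\alpha$ with $\alpha\in\mathcal A$ and with $\varphi\in\mathcal A$ or $\varphi=\overline{\beta}$ for some $\beta\in\mathcal A$. For $A,B\subseteq\mathcal A$: $A$ attacks $B$ if there are $\beta\in B$, $A'\subseteq A$ and $R\subseteq\mathcal R$ with $A'\vdash^R\overline{\beta}$; $A$ is closed if $A=\{\alpha\in\mathcal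 A:\ A'\vdash^R\alpha\text{ for some }A'\subseteq A,\ R\subseteq\mathcal R\}$; $A$ is conflict-free if it does not attack itself; $A$ defends $\alpha\in\mathcal A$ if $A$ attacks every closed $B\subseteq\mathcal A$ that attacks $\{\alpha\}$; and $A$ is admissible if it is closed, conflict-free and defends each of its elements. Consider the following decision problem. Given a finite bipolar ABA framework $\mathcal F$ (finite $\mathcal L$ and $\mathcal R$, sentences being named by binary words, and $\mathcal L$, $\mathcal R$, $\mathcal A$ and the contrary map being listed explicitly) and a set $A\subseteq\mathcal A$ (also listed explicitly), is $A$ admissible in $\mathcal F$? Proposition. This problem is in $\mathsf P$: the set of words over a fixed finite alphabet that encode a pair $(\mathcal F,A)$ with $\mathcal F$ a finite bipolar ABA framework and $A$ an admissible extension of $\mathcal F$ is decided by a Turing machine in time polynomial in the length of the word. -/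

import Mathlib

/-! ### Assumption-based argumentation (ABA) -/

namespace ABA

/-- A rule `head ← body` over sentences of type `S`; the body is a finite, possibly empty sequence. -/
structure Rule (S : Type*) where
  head : S
  body : List S

/-- An ABA framework: a language, a set of rules over it, a non-empty set of assumptions,
and a total contrary map from the assumptions to the language. -/
structure Framework (S : Type*) where
  lang : Set S
  rules : Set (Rule S)
  head_mem : ∀ r ∈ rules, r.head ∈ lang
  body_mem : ∀ r ∈ rules, ∀ φ ∈ r.body, φ ∈ lang
  assumptions : Set S
  assumptions_subset : assumptions ⊆ lang
  assumptions_nonempty : assumptions.Nonempty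
  contrary : assumptions → lang

namespace Framework

variable {S : Type*} (F : Framework S)

/-- `F.Deduction A R φ`: there is a finite deduction tree with root labelled `φ`, such that `A` is
exactly the set of assumptions labelling its leaves and `R` exactly the set of rules used in it.
A rule with empty body has no premises, and so contributes no assumption. -/
inductive Deduction : Set S → Set (Rule S) → S → Prop
  | leaf (α : S) (hα : α ∈ F.assumptions) : Deduction {α} ∅ α
  | node (r : Rule S) (hr : r ∈ F.rules)
      (A : Fin r.body.length → Set S) (R : Fin r.body.length → Set (Rule S))
      (h : ∀ i, Deduction (A i) (R i) (r.body.get i)) :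
      Deduction (⋃ i, A i) (insert r (⋃ i, R i)) r.head

/-- `A` attacks `B`: the contrary of some assumption in `B` is deducible from a subset of `A`. -/
def Attacks (A B : Set S) : Prop :=
  ∃ β : F.assumptions, (β : S) ∈ B ∧
    ∃ A' ⊆ A, ∃ R ⊆ F.rules, F.Deduction A' R (F.contrary β : S)

/-- The closure of `A`: all assumptions deducible from subsets of `A`. -/
def cl (A : Set S) : Set S :=
  {α | α ∈ F.assumptions ∧ ∃ A' ⊆ A, ∃ R ⊆ F.rules, F.Deduction A' R α}

/-- `A` is closed. -/
def Closed (A : Set S) : Prop := A = F.cl A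

/-- `A` is conflict-free. -/
def ConflictFree (A : Set S) : Prop := ¬ F.Attacks A A

/-- `A` defends the assumption `α`. -/
def Defends (A : Set S) (α : S) : Prop :=
  ∀ B ⊆ F.assumptions, F.Closed B → F.Attacks B {α} → F.Attacks A B

/-- `A` is an admissible extension. -/
def Admissible (A : Set S) : Prop :=
  A ⊆ F.assumptions ∧ F.Closed A ∧ F.ConflictFree A ∧ ∀ α ∈ A, F.Defends A α

/-- `F` is bipolar: every rule has the form `φ ← α` with `α` an assumption and `φ` an assumption
or the contrary of an assumption. -/
def Bipolar : Prop :=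
  ∀ r ∈ F.rules, ∃ α ∈ F.assumptions, r.body = [α] ∧
    (r.head ∈ F.assumptions ∨ ∃ β : F.assumptions, r.head = (F.contrary β : S))

end Framework

/-! ### Instances of the verification problem as words -/

/-- The input alphabet: two bits, an end marker for sentences and an end marker for lists. -/
inductive Letter
  | zero
  | one
  | comma
  | close
  deriving DecidableEq

instance : Fintype Letter where
  elems := {Letter.zero, Letter.one, Letter.comma, Letter.close}
  complete := by intro x; cases x <;> decide

/-- Sentences are named by binary words. -/
abbrev Sentence : Type := List Bool

/-- A finite listing of the data of an ABA framework together with a set of sentences. The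
assumptions are given through the graph of the contrary map. Order and repetition are free. -/
structure Listing where
  lang : List Sentence
  rules : List (Rule Sentence)
  contraries : List (Sentence × Sentence)
  candidate : List Sentence

/-- The listing `D` describes the framework `F` and the set `A`. -/
def Listing.Describes (D : Listing) (F : Framework Sentence) (A : Set Sentence) : Prop :=
  (∀ φ, φ ∈ D.lang ↔ φ ∈ F.lang) ∧
  (∀ r, r ∈ D.rules ↔ r ∈ F.rules) ∧
  (∀ α φ, (α, φ) ∈ D.contraries ↔ ∃ hα : α ∈ F.assumptions, (F.contrary ⟨α, hα⟩ : Sentence) = φ) ∧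
  (∀ φ, φ ∈ D.candidate ↔ φ ∈ A)

/-- The code of one bit. -/
def encodeBit (b : Bool) : Letter := if b then Letter.one else Letter.zero

/-- The code of a sentence. -/
def encodeSentence (φ : Sentence) : List Letter := φ.map encodeBit ++ [Letter.comma]

/-- The code of a list, given codes of its members. -/
def encodeList {α : Type} (e : α → List Letter) (l : List α) : List Letter :=
  l.flatMap e ++ [Letter.close]

/-- The code of a rule: its head followed by its body. -/
def encodeRule (r : Rule Sentence) : List Letter := encodeList encodeSentence (r.head :: r.body)

/-- The code of a pair of sentences. -/
def encodePair (p : Sentence × Sentence) : List Letter := encodeSentence p.1 ++ encodeSentence p.2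

/-- The code of a listing. -/
def Listing.encode (D : Listing) : List Letter :=
  encodeList encodeSentence D.lang ++ (encodeList encodeRule D.rules ++
    (encodeList encodePair D.contraries ++ encodeList encodeSentence D.candidate))

/-- The verification problem for admissible semantics of bipolar ABA frameworks, as a language:
the words that encode a bipolar ABA framework `F` and a set `A` of its assumptions such that
`A` is an admissible extension of `F`. -/
def verAdm : Language Letter :=
  {w | ∃ (D : Listing) (F : Framework Sentence) (A : Set Sentence),
    w = D.encode ∧ D.Describes F A ∧ F.Bipolar ∧ A ⊆ F.assumptions ∧ F.Admissible A}

/-! ### The code is unambiguous -/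

theorem encodeSentence_cancel (φ ψ : Sentence) (x y : List Letter)
    (h : encodeSentence φ ++ x = encodeSentence ψ ++ y) : φ = ψ ∧ x = y := by
  induction φ generalizing ψ with
  | nil =>
    cases ψ with
    | nil => simpa [encodeSentence] using h
    | cons c ψ => cases c <;> simp [encodeSentence, encodeBit] at h
  | cons b φ ih =>
    cases ψ with
    | nil => cases b <;> simp [encodeSentence, encodeBit] at h
    | cons c ψ =>
      have h' : encodeBit b = encodeBit c ∧ encodeSentence φ ++ x = encodeSentence ψ ++ y := by
        simpa [encodeSentence] using h
      obtain ⟨rfl, rfl⟩ := ih ψ h'.2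
      refine ⟨?_, rfl⟩
      cases b <;> cases c <;> simp_all [encodeBit]

theorem encodeSentence_ne_close (φ : Sentence) (x y : List Letter) :
    encodeSentence φ ++ x ≠ Letter.close :: y := by
  cases φ with
  | nil => simp [encodeSentence]
  | cons b φ => cases b <;> simp [encodeSentence, encodeBit]

theorem encodeList_cancel {α : Type} (e : α → List Letter)
    (he : ∀ a b x y, e a ++ x = e b ++ y → a = b ∧ x = y)
    (hs : ∀ a x y, e a ++ x ≠ Letter.close :: y) (l m : List α) (x y : List Letter)
    (h : encodeList e l ++ x = encodeList e m ++ y) : l = m ∧ x = y := by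
  induction l generalizing m with
  | nil =>
    cases m with
    | nil => simpa [encodeList] using h
    | cons b m => exact absurd (by simpa [encodeList] using h.symm) (hs b _ x)
  | cons a l ih =>
    cases m with
    | nil => exact absurd (by simpa [encodeList] using h) (hs a _ y)
    | cons b m =>
      have h' : e a ++ (encodeList e l ++ x) = e b ++ (encodeList e m ++ y) := by
        simpa [encodeList] using h
      obtain ⟨rfl, h2⟩ := he _ _ _ _ h'
      obtain ⟨rfl, rfl⟩ := ih m h2
      exact ⟨rfl, rfl⟩

/-- Different listings have different codes. -/
theorem Listing.encode_injective : Function.Injective Listing.encode := by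
  intro D E h
  have hw := encodeList_cancel encodeSentence encodeSentence_cancel encodeSentence_ne_close
  have hr := encodeList_cancel encodeRule
    (fun a b x y hab => by
      obtain ⟨h1, h2⟩ := hw _ _ x y hab
      obtain ⟨h3, h4⟩ := List.cons.inj h1
      cases a
      cases b
      cases h3
      cases h4
      exact ⟨rfl, h2⟩)
    (fun a x y hax => encodeSentence_ne_close a.head (encodeList encodeSentence a.body ++ x) y
      (by simpa [encodeRule, encodeList] using hax))
  have hp := encodeList_cancel encodePair
    (fun a b x y hab => by
      simp only [encodePair, List.append_assoc] at hab
      obtain ⟨h1, h2⟩ := encodeSentence_cancel _ _ _ _ hab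
      obtain ⟨h3, h4⟩ := encodeSentence_cancel _ _ _ _ h2
      exact ⟨Prod.ext h1 h3, h4⟩)
    (fun a x y hax => encodeSentence_ne_close a.1 (encodeSentence a.2 ++ x) y
      (by simpa [encodePair] using hax))
  obtain ⟨h1, h⟩ := hw _ _ _ _ h
  obtain ⟨h2, h⟩ := hr _ _ _ _ h
  obtain ⟨h3, h⟩ := hp _ _ _ _ h
  obtain ⟨h4, -⟩ := hw D.candidate E.candidate [] [] (by simpa using h)
  cases D
  cases E
  cases h1
  cases h2
  cases h3
  cases h4
  rfl

end ABA

/-- The complexity class P: `L` is decided by a Turing machine (Mathlib's multi-stack model, with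
finitely many stacks, labels and states) that, on every word over the alphabet, halts with the
answer within a number of steps polynomial in the length of the word. -/
def InP {Γ : Type} (L : Language Γ) : Prop :=
  ∃ f : List Γ → Bool, (∀ w, f w = true ↔ w ∈ L) ∧
    Nonempty (Turing.TM2ComputableInPolyTime id Computability.encodeBool f)

/-! A rule of a bipolar framework has exactly one premise. A deduction is therefore a path in the
graph with an edge from the premise to the head of each rule, and every vertex of a path except
possibly the last is an assumption. So a set of assumptions is closed as soon as no edge leads from
it to an assumption outside it, and whatever a closed set derives lies in it or one edge away
(`Bipolar.derivable_iff`, `Bipolar.closed_iff`, `Bipolar.derivable_iff_near`).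

Only defence quantifies over sets. The assumptions reachable from an assumption `b` form a closed
set contained in every closed set around `b`, so `A` defends `α` iff each assumption `b` with a path
to the contrary of `α` is doomed: `b` reaches an assumption whose contrary is at most one edge away
from `A`. Doom spreads backwards along edges, so it is enough to inspect that contrary itself and
its immediate predecessors (`Bipolar.defends_iff`). Admissibility is now a first-order condition on
the listed data, apart from doom, which is a least fixed point (`Bipolar.admissible_iff`). It is
computed by rounds of marking. Until the marking is complete each round marks a new pair, so more
rounds than there are listed contraries suffice (`complete_or_card`), and the length of the input is
such a number (`length_lt_encode`).

The machine is composed of program fragments that carry time bounds. A finite transducer rewrites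
the input as a list of records and counts its letters in unary; it accepts exactly the codes of
listings whose rules have one premise (`transduce_encode`, `exists_of_transduce`). First-order
conditions are evaluated with one copy of the records per variable, the head of the copy serving as
the value of the variable. Each quantifier is a scan, which preserves polynomial time (`Test`,
`runs_search`). Marking rounds are repeated as often as the counter says, and a final test is run
(`runs_repeatProg`, `runs_answer`, `inP_of_tests`). `mem_verAdm_iff` says that this decides the
right language. -/

namespace Turing.TM2

/-! ### Program fragments with exits, their composition and their running times -/

section Relabel

variable {K : Type} {Γ : K → Type} {Λ Λ' σ : Type}

/-- Rename the jump targets of a statement. -/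
def Stmt.relabel (f : Λ → Λ') : Stmt Γ Λ σ → Stmt Γ Λ' σ
  | .push k a q => .push k a (q.relabel f)
  | .peek k a q => .peek k a (q.relabel f)
  | .pop k a q => .pop k a (q.relabel f)
  | .load a q => .load a (q.relabel f)
  | .branch c q₁ q₂ => .branch c (q₁.relabel f) (q₂.relabel f)
  | .goto l => .goto (f ∘ l)
  | .halt => .halt

/-- Rename the label of a configuration. -/
def Cfg.relabel (f : Λ → Λ') (c : Cfg Γ Λ σ) : Cfg Γ Λ' σ := ⟨c.l.map f, c.var, c.stk⟩

/-- Labels only name where control goes next; variable and stacks never depend on them. -/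
theorem stepAux_relabel [DecidableEq K] (f : Λ → Λ') (q : Stmt Γ Λ σ) (v : σ)
    (S : ∀ k, List (Γ k)) : stepAux (q.relabel f) v S = (stepAux q v S).relabel f := by
  induction q generalizing v S with
  | branch c q₁ q₂ ih₁ ih₂ => cases h : c v <;> simp [Stmt.relabel, h, ih₁, ih₂]
  | _ => simp_all [Stmt.relabel, Cfg.relabel]

end Relabel

end Turing.TM2

open Turing in
/-- A program fragment for the multi-stack machine: finitely many labelled statements, which may
also jump to one of the exits in `E`. -/
structure Frag {K : Type} (Γ : K → Type) (σ E : Type) where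
  Λ : Type
  finite : Finite Λ
  entry : Λ
  code : Λ → TM2.Stmt Γ (Λ ⊕ E) σ

namespace Frag

open Turing

variable {K : Type} [DecidableEq K] {Γ : K → Type} {σ E E' Q : Type}

/-- `F.Steps n x v S y v' S'`: control passes from `x` to `y` in exactly `n` steps. -/
inductive Steps (F : Frag Γ σ E) : ℕ → F.Λ ⊕ E → σ → (∀ k, List (Γ k)) →
    F.Λ ⊕ E → σ → (∀ k, List (Γ k)) → Prop
  | refl (x v S) : Steps F 0 x v S x v S
  | head {n l v S x v₁ S₁ y v' S'} (h : TM2.stepAux (F.code l) v S = ⟨some x, v₁, S₁⟩)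
      (hs : Steps F n x v₁ S₁ y v' S') : Steps F (n + 1) (Sum.inl l) v S y v' S'

theorem Steps.trans {F : Frag Γ σ E} {m n x v S y v₁ S₁ z v₂ S₂}
    (h : F.Steps m x v S y v₁ S₁) (h' : F.Steps n y v₁ S₁ z v₂ S₂) :
    F.Steps (m + n) x v S z v₂ S₂ := by
  induction h with
  | refl => simpa using h'
  | head e _ ih => rw [Nat.add_right_comm]; exact .head e (ih h')

/-- The simulation behind all combinators: each of them contains copies of its parts that differ
only in their jump targets, with exits redirected by `h`. -/
theorem Steps.embed {F : Frag Γ σ E} {G : Frag Γ σ E'} (g : F.Λ → G.Λ) (h : E → G.Λ ⊕ E')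
    (hc : ∀ l, G.code (g l) = (F.code l).relabel (Sum.elim (Sum.inl ∘ g) h))
    {n x v S y v' S'} (hs : F.Steps n x v S y v' S') :
    G.Steps n (Sum.elim (Sum.inl ∘ g) h x) v S (Sum.elim (Sum.inl ∘ g) h y) v' S' := by
  induction hs with
  | refl => exact .refl _ _ _
  | head e _ ih =>
    refine .head (l := g _) ?_ ih
    rw [hc, TM2.stepAux_relabel, e]
    rfl

/-- Started with stacks `S`, the fragment leaves through exit `e` with stacks `S'` after at most
`t` steps. -/
def Runs (F : Frag Γ σ E) (S : ∀ k, List (Γ k)) (e : E) (S' : ∀ k, List (Γ k)) (t : ℕ) : Prop :=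
  ∀ v, ∃ v', ∃ n ≤ t, F.Steps n (Sum.inl F.entry) v S (Sum.inr e) v' S'

theorem Runs.mono {F : Frag Γ σ E} {S e S' t t'} (h : F.Runs S e S' t) (ht : t ≤ t') :
    F.Runs S e S' t' := fun v =>
  let ⟨v', n, hn, hs⟩ := h v
  ⟨v', n, hn.trans ht, hs⟩

/-- A single loop-free statement. -/
def atom (q : TM2.Stmt Γ E σ) : Frag Γ σ E where
  Λ := Unit
  finite := inferInstance
  entry := ()
  code _ := q.relabel Sum.inr

theorem runs_atom {q : TM2.Stmt Γ E σ} {S e S'}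
    (h : ∀ v, ∃ v', TM2.stepAux q v S = ⟨some e, v', S'⟩) : (atom q).Runs S e S' 1 := by
  intro v
  obtain ⟨v', hv⟩ := h v
  refine ⟨v', 1, le_rfl, .head (x := Sum.inr e) (v₁ := v') (S₁ := S') ?_ (.refl _ _ _)⟩
  change TM2.stepAux (q.relabel Sum.inr) v S = _
  rw [TM2.stepAux_relabel, hv]
  rfl

/-- Rename the exits. -/
def map (f : E → E') (F : Frag Γ σ E) : Frag Γ σ E' where
  Λ := F.Λ
  finite := F.finite
  entry := F.entry
  code l := (F.code l).relabel (Sum.elim (Sum.inl ∘ id) (Sum.inr ∘ f))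

theorem Runs.map {F : Frag Γ σ E} {S e S' t} (f : E → E') (h : F.Runs S e S' t) :
    (F.map f).Runs S (f e) S' t := by
  intro v
  obtain ⟨v', n, hn, hs⟩ := h v
  have := hs.embed (F := F) (G := F.map f) id (fun e => Sum.inr (f e)) fun _ => rfl
  exact ⟨v', n, hn, this⟩

/-- Run `F`, then the continuation chosen by the exit taken. -/
def bind [Finite E] (F : Frag Γ σ E) (G : E → Frag Γ σ E') : Frag Γ σ E' where
  Λ := F.Λ ⊕ Σ e, (G e).Λ
  finite := by
    have := F.finite
    have := fun e => (G e).finite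
    infer_instance
  entry := Sum.inl F.entry
  code
    | Sum.inl l => (F.code l).relabel
        (Sum.elim (Sum.inl ∘ Sum.inl) fun e => Sum.inl (Sum.inr ⟨e, (G e).entry⟩))
    | Sum.inr ⟨e, l⟩ => ((G e).code l).relabel
        (Sum.elim (Sum.inl ∘ fun l => Sum.inr ⟨e, l⟩) Sum.inr)

theorem Runs.bind [Finite E] {F : Frag Γ σ E} {G : E → Frag Γ σ E'} {S e S₁ e' S₂ t₁ t₂}
    (h₁ : F.Runs S e S₁ t₁) (h₂ : (G e).Runs S₁ e' S₂ t₂) :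
    (F.bind G).Runs S e' S₂ (t₁ + t₂) := by
  intro v
  obtain ⟨v₁, n₁, hn₁, hs₁⟩ := h₁ v
  obtain ⟨v₂, n₂, hn₂, hs₂⟩ := h₂ v₁
  exact ⟨v₂, n₁ + n₂, by omega,
    (hs₁.embed (G := F.bind G) Sum.inl (fun e => Sum.inl (Sum.inr ⟨e, (G e).entry⟩))
      fun _ => rfl).trans
    (hs₂.embed (G := F.bind G) (fun l => Sum.inr ⟨e, l⟩) Sum.inr fun _ => rfl)⟩

/-- Repeat a fragment with a parameter, until it asks to leave. -/
def iter [Finite Q] (F : Q → Frag Γ σ (Q ⊕ E)) (q : Q) : Frag Γ σ E where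
  Λ := Σ q, (F q).Λ
  finite := by
    have := fun q => (F q).finite
    infer_instance
  entry := ⟨q, (F q).entry⟩
  code := fun ⟨q, l⟩ => ((F q).code l).relabel
    (Sum.elim (Sum.inl ∘ fun l => ⟨q, l⟩)
      (Sum.elim (fun q' => Sum.inl ⟨q', (F q').entry⟩) Sum.inr))

theorem Runs.iter_exit [Finite Q] {F : Q → Frag Γ σ (Q ⊕ E)} {q S e S' t}
    (h : (F q).Runs S (Sum.inr e) S' t) : (iter F q).Runs S e S' t := fun v =>
  let ⟨v', n, hn, hs⟩ := h v
  ⟨v', n, hn, hs.embed (G := iter F q) (fun l => ⟨q, l⟩)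
    (Sum.elim (fun q' => Sum.inl ⟨q', (F q').entry⟩) Sum.inr) fun _ => rfl⟩

/-- The parameter of `iter` selects the entry point only; the code is the same for all parameters.
This lets the run after a repetition be read as a run of the original loop. -/
theorem Steps.iter_param [Finite Q] {F : Q → Frag Γ σ (Q ⊕ E)} {q q' n x v S y v' S'}
    (h : (iter F q).Steps n x v S y v' S') : (iter F q').Steps n x v S y v' S' := by
  induction h with
  | refl => exact .refl _ _ _
  | head e _ ih => exact .head e ih

theorem Runs.iter_again [Finite Q] {F : Q → Frag Γ σ (Q ⊕ E)} {q q' S S₁ e S₂ t₁ t₂}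
    (h₁ : (F q).Runs S (Sum.inl q') S₁ t₁) (h₂ : (iter F q').Runs S₁ e S₂ t₂) :
    (iter F q).Runs S e S₂ (t₁ + t₂) := by
  intro v
  obtain ⟨v₁, n₁, hn₁, hs₁⟩ := h₁ v
  obtain ⟨v₂, n₂, hn₂, hs₂⟩ := h₂ v₁
  exact ⟨v₂, n₁ + n₂, by omega,
    (hs₁.embed (G := iter F q) (fun l => ⟨q, l⟩)
      (Sum.elim (fun q' => Sum.inl ⟨q', (F q').entry⟩) Sum.inr) fun _ => rfl).trans hs₂.iter_param⟩

/-- Leave at once. -/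
def pure (e : E) : Frag Γ σ E := atom (.goto fun _ => e)

theorem runs_pure (e : E) (S : ∀ k, List (Γ k)) : (pure e : Frag Γ σ E).Runs S e S 1 :=
  runs_atom fun v => ⟨v, rfl⟩

/-- Put a symbol on a stack. -/
def push (k : K) (a : Γ k) : Frag Γ σ Unit := atom (.push k (fun _ => a) (.goto fun _ => ()))

theorem runs_push (k : K) (a : Γ k) (S : ∀ k, List (Γ k)) :
    (push k a : Frag Γ σ Unit).Runs S () (Function.update S k (a :: S k)) 1 :=
  runs_atom fun v => ⟨v, rfl⟩

/-- Take a symbol off a stack; `f` stores it in the internal state and `g` reads it. -/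
def pop (k : K) (f : σ → Option (Γ k) → σ) (g : σ → E) : Frag Γ σ E := atom (.pop k f (.goto g))

theorem runs_pop (k : K) (f : σ → Option (Γ k) → σ) (g : σ → E) (S : ∀ k, List (Γ k)) (e : E)
    (he : ∀ v, g (f v (S k).head?) = e) :
    (pop k f g).Runs S e (Function.update S k (S k).tail) 1 :=
  runs_atom fun v => ⟨f v (S k).head?, by simp [he]⟩

/-- Empty a stack. -/
def clear (k : K) (f : σ → Option (Γ k) → σ) (g : σ → Bool) : Frag Γ σ Unit :=
  iter (fun _ : Unit => pop k f fun v => if g v then Sum.inl () else Sum.inr ()) ()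

theorem runs_clear (k : K) (f : σ → Option (Γ k) → σ) (g : σ → Bool)
    (hg : ∀ v a, g (f v a) = a.isSome) (S : ∀ k, List (Γ k)) :
    (clear k f g).Runs S () (Function.update S k []) ((S k).length + 1) := by
  generalize h : S k = l
  induction l generalizing S with
  | nil =>
    refine .iter_exit ?_
    have := runs_pop k f (fun v => if g v then Sum.inl () else Sum.inr ()) S (Sum.inr ())
      (by simp [hg, h])
    simpa [h] using this
  | cons a l ih =>
    have := runs_pop k f (fun v => if g v then Sum.inl () else Sum.inr ()) S (Sum.inl ())
      (by simp [hg, h])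
    have h2 := Runs.iter_again (q := ()) this (ih (Function.update S k (S k).tail) (by simp [h]))
    rw [Function.update_idem] at h2
    exact h2.mono (by simp [Nat.add_comm])

/-! ### From fragments to machines in Mathlib's sense -/

/-- The machine that runs a fragment, restores the internal state and halts. -/
noncomputable def toFinTM2 [Fintype K] [Fintype σ] (F : Frag Γ σ Unit) (k₀ k₁ : K) [Fintype (Γ k₀)]
    (v₀ : σ) : FinTM2 where
  K := K
  k₀ := k₀
  k₁ := k₁
  Γ := Γ
  Λ := F.Λ ⊕ Unit
  main := Sum.inl F.entry
  ΛFin := by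
    have := F.finite
    exact Fintype.ofFinite _
  σ := σ
  initialState := v₀
  m
    | Sum.inl l => F.code l
    | Sum.inr _ => .load (fun _ => v₀) .halt

theorem Steps.iterate [Fintype K] [Fintype σ] {F : Frag Γ σ Unit} {k₀ k₁ : K} [Fintype (Γ k₀)]
    {v₀ : σ} {n x v S y v' S'} (h : F.Steps n x v S y v' S') :
    (flip Bind.bind (F.toFinTM2 k₀ k₁ v₀).step)^[n]
      (some (⟨some x, v, S⟩ : (F.toFinTM2 k₀ k₁ v₀).Cfg)) =
      some (⟨some y, v', S'⟩ : (F.toFinTM2 k₀ k₁ v₀).Cfg) := by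
  induction h with
  | refl => rfl
  | @head n l v S x v₁ S₁ y v' S' e _ ih =>
    rw [Function.iterate_succ_apply, ← ih]
    congr 1
    exact congrArg some e

/-- The one extra step is taken at the exit label, where the initial state is reloaded and the
machine halts; a final configuration of `FinTM2` must have that state. -/
theorem Runs.evalsTo [Fintype K] [Fintype σ] {F : Frag Γ σ Unit} {k₀ k₁ : K} [Fintype (Γ k₀)]
    {v₀ : σ} {S S' t} (h : F.Runs S () S' t) :
    Nonempty (StateTransition.EvalsToInTime (F.toFinTM2 k₀ k₁ v₀).step
      (⟨some (Sum.inl F.entry), v₀, S⟩ : (F.toFinTM2 k₀ k₁ v₀).Cfg)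
      (some (⟨none, v₀, S'⟩ : (F.toFinTM2 k₀ k₁ v₀).Cfg)) (t + 1)) := by
  obtain ⟨v', n, hn, hs⟩ := h v₀
  refine ⟨⟨⟨n + 1, ?_⟩, Nat.succ_le_succ hn⟩⟩
  have := hs.iterate (k₀ := k₀) (k₁ := k₁) (v₀ := v₀)
  exact (Function.iterate_succ_apply' _ _ _).trans ((congrArg _ this).trans rfl)

end Frag


/-! ### Work tapes as pairs of stacks, and movements of their heads -/

namespace ABA

/-- The kinds of records that a listing consists of. -/
inductive Tag
  | lang
  | rule
  | contr
  | cand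
  deriving DecidableEq

instance : Fintype Tag where
  elems := {Tag.lang, Tag.rule, Tag.contr, Tag.cand}
  complete := by intro x; cases x <;> decide

/-- The alphabet of the work tapes. The flag of a tag symbol is the mark of its record. -/
inductive Sym
  | tag (t : Tag) (m : Bool)
  | bit (b : Bool)
  | comma
  deriving DecidableEq, Fintype

/-- The stacks: input, output, a unary counter, and the two halves of four work tapes. -/
inductive Stack
  | inp
  | out
  | cnt
  | tape (d : Bool) (i : Fin 4)
  deriving DecidableEq, Fintype

/-- The alphabet of each stack. -/
abbrev Alphabet : Stack → Type
  | .inp => Letter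
  | .out => Bool
  | .cnt => Unit
  | .tape _ _ => Sym

/-- The internal state of the machine holds the result of the last pop. -/
abbrev Reg : Type := Option Sym × Option Letter × Bool

abbrev Prog (E : Type) : Type 1 := Frag Alphabet Reg E

/-- The part of a tape before the head, reversed, and the part after it. -/
abbrev Zipper : Type := List Sym × List Sym

abbrev Tapes : Type := Fin 4 → Zipper

/-- The stacks with input `w`, output `o`, counter `n` and tapes `T`. -/
def layout (w : List Letter) (o : List Bool) (n : ℕ) (T : Tapes) : ∀ k, List (Alphabet k)
  | .inp => w
  | .out => o
  | .cnt => List.replicate n ()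
  | .tape false i => (T i).1
  | .tape true i => (T i).2

/-- The zipper whose half on side `d` is `s`, the other half being `t`. -/
def zip (d : Bool) (s t : List Sym) : Zipper := if d then (t, s) else (s, t)

theorem update_layout_tape (w o n T) (d : Bool) (i : Fin 4) {s t s' : List Sym}
    (h : T i = zip d s t) :
    Function.update (layout w o n T) (.tape d i) s' =
      layout w o n (Function.update T i (zip d s' t)) := by
  funext k
  by_cases hk : k = .tape d i
  · subst hk
    cases d <;> simp [layout, zip]
  · rw [Function.update_of_ne hk]
    rcases k with _ | _ | _ | ⟨e, j⟩
    · rfl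
    · rfl
    · rfl
    · by_cases hj : j = i
      · subst hj
        cases d <;> cases e <;> simp_all [layout, zip]
      · cases e <;> simp [layout, hj]

theorem layout_tape (w o n T) (d : Bool) (i : Fin 4) {s t : List Sym} (h : T i = zip d s t) :
    layout w o n T (.tape d i) = s := by
  cases d <;> simp [layout, zip, h]

/-- A program that only works on the tapes. -/
def TapeRuns {E : Type} (F : Prog E) (T : Tapes) (e : E) (T' : Tapes) (t : ℕ) : Prop :=
  ∀ w o n, F.Runs (layout w o n T) e (layout w o n T') t

namespace TapeRuns

variable {E E' Q : Type} {T T₁ T₂ : Tapes} {t t₁ t₂ : ℕ}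

theorem mono {F : Prog E} {e} (h : TapeRuns F T e T₁ t) (ht : t ≤ t₁) : TapeRuns F T e T₁ t₁ :=
  fun w o n => (h w o n).mono ht

theorem bind [Finite E] {F : Prog E} {G : E → Prog E'} {e e'} (h₁ : TapeRuns F T e T₁ t₁)
    (h₂ : TapeRuns (G e) T₁ e' T₂ t₂) : TapeRuns (F.bind G) T e' T₂ (t₁ + t₂) :=
  fun w o n => (h₁ w o n).bind (h₂ w o n)

theorem map {F : Prog E} {e} (f : E → E') (h : TapeRuns F T e T₁ t) :
    TapeRuns (F.map f) T (f e) T₁ t :=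
  fun w o n => (h w o n).map f

theorem iter_exit [Finite Q] {F : Q → Prog (Q ⊕ E)} {q e}
    (h : TapeRuns (F q) T (Sum.inr e) T₁ t) : TapeRuns (Frag.iter F q) T e T₁ t :=
  fun w o n => (h w o n).iter_exit

theorem iter_again [Finite Q] {F : Q → Prog (Q ⊕ E)} {q q' e}
    (h₁ : TapeRuns (F q) T (Sum.inl q') T₁ t₁) (h₂ : TapeRuns (Frag.iter F q') T₁ e T₂ t₂) :
    TapeRuns (Frag.iter F q) T e T₂ (t₁ + t₂) :=
  fun w o n => (h₁ w o n).iter_again (h₂ w o n)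

theorem pure (e : E) : TapeRuns (Frag.pure e) T e T 1 := fun _ _ _ => Frag.runs_pure _ _

end TapeRuns

/-- Take a symbol off one half of a tape. -/
def popTape (d : Bool) (i : Fin 4) : Prog (Option Sym) :=
  Frag.pop (Γ := Alphabet) (.tape d i) (fun v a => (a, v.2)) Prod.fst

/-- Put a symbol on one half of a tape. -/
def pushTape (d : Bool) (i : Fin 4) (a : Sym) : Prog Unit := Frag.push (Γ := Alphabet) (.tape d i) a

theorem runs_popTape {d : Bool} {i : Fin 4} {T : Tapes} {s t : List Sym} (h : T i = zip d s t) :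
    TapeRuns (popTape d i) T s.head? (Function.update T i (zip d s.tail t)) 1 := by
  intro w o n
  have := Frag.runs_pop (Γ := Alphabet) (σ := Reg) (.tape d i) (fun v a => (a, v.2)) Prod.fst
    (layout w o n T) s.head? (fun v => congrArg List.head? (layout_tape w o n T d i h))
  rw [update_layout_tape _ _ _ _ _ _ h, layout_tape _ _ _ _ _ _ h] at this
  exact this

theorem runs_pushTape {d : Bool} {i : Fin 4} {T : Tapes} {s t : List Sym} (a : Sym)
    (h : T i = zip d s t) :
    TapeRuns (pushTape d i a) T () (Function.update T i (zip d (a :: s) t)) 1 := by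
  intro w o n
  have := Frag.runs_push (Γ := Alphabet) (σ := Reg) (.tape d i) a (layout w o n T)
  rw [update_layout_tape _ _ _ _ _ _ h, layout_tape _ _ _ _ _ _ h] at this
  exact this

theorem zip_not (d : Bool) (s t : List Sym) : zip (!d) s t = zip d t s := by cases d <;> rfl

/-- Move one symbol from the half of tape `i` on side `d` to the other half, unless it satisfies
`isStop`; in this case move it if `back` does not hold, and leave. -/
def shiftStep (d : Bool) (i : Fin 4) (isStop : Sym → Bool) (back : Bool) : Prog (Unit ⊕ Bool) :=
  (popTape d i).bind fun
    | none => Frag.pure (Sum.inr false)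
    | some x =>
      if isStop x then (pushTape (if back then d else !d) i x).map fun _ => Sum.inr true
      else (pushTape (!d) i x).map fun _ => Sum.inl ()

/-- Move the head of tape `i` in direction `d`, to the first symbol with `isStop` or else to the end.
At the symbol found, the head ends before it if `back`, behind it otherwise. -/
def shift (d : Bool) (i : Fin 4) (isStop : Sym → Bool) (back : Bool) : Prog Bool :=
  Frag.iter (fun _ : Unit => shiftStep d i isStop back) ()

section Shift

variable {d : Bool} {i : Fin 4} {isStop : Sym → Bool} {T : Tapes} {x : Sym} {s t xs : List Sym}

theorem runs_shiftStep_nil {back : Bool} (h : T i = zip d [] t) :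
    TapeRuns (shiftStep d i isStop back) T (Sum.inr false) T 2 := by
  have h₁ := runs_popTape h
  rw [List.tail_nil, ← h, Function.update_eq_self] at h₁
  exact TapeRuns.bind h₁ (t₂ := 1) (TapeRuns.pure _)

theorem runs_shiftStep_cons {back : Bool} (h : T i = zip d (x :: s) t) (hx : isStop x = false) :
    TapeRuns (shiftStep d i isStop back) T (Sum.inl ()) (Function.update T i (zip d s (x :: t))) 2 := by
  refine TapeRuns.bind (runs_popTape h) (t₂ := 1) ?_
  simp only [List.head?_cons, hx, List.tail_cons, Bool.false_eq_true, if_false]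
  have := (runs_pushTape (d := !d) (i := i) (T := Function.update T i (zip d s t)) x
    (by rw [Function.update_self, zip_not])).map (fun _ => (Sum.inl () : Unit ⊕ Bool))
  rwa [Function.update_idem, zip_not] at this

theorem runs_shiftStep_past (h : T i = zip d (x :: s) t) (hx : isStop x = true) :
    TapeRuns (shiftStep d i isStop false) T (Sum.inr true)
      (Function.update T i (zip d s (x :: t))) 2 := by
  refine TapeRuns.bind (runs_popTape h) (t₂ := 1) ?_
  simp only [List.head?_cons, hx, List.tail_cons, if_true]
  have := (runs_pushTape (d := !d) (i := i) (T := Function.update T i (zip d s t)) x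
    (by rw [Function.update_self, zip_not])).map (fun _ => (Sum.inr true : Unit ⊕ Bool))
  rwa [Function.update_idem, zip_not] at this

theorem runs_shiftStep_before (h : T i = zip d (x :: s) t) (hx : isStop x = true) :
    TapeRuns (shiftStep d i isStop true) T (Sum.inr true) T 2 := by
  refine TapeRuns.bind (runs_popTape h) (t₂ := 1) ?_
  simp only [List.head?_cons, hx, List.tail_cons, if_true]
  have := (runs_pushTape (d := d) (i := i) (T := Function.update T i (zip d s t)) x
    (by rw [Function.update_self])).map (fun _ => (Sum.inr true : Unit ⊕ Bool))
  rwa [Function.update_idem, ← h, Function.update_eq_self] at this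

/-- The common part of the three ways in which a shift can end: passing each non-stop symbol costs a
pop and a push, and the run then goes on from `s`. -/
theorem shift_of_forall {back : Bool} {b : Bool} {T' : Tapes} {k : ℕ}
    (h : T i = zip d (xs ++ s) t) (hxs : ∀ x ∈ xs, isStop x = false)
    (h' : TapeRuns (shift d i isStop back) (Function.update T i (zip d s (xs.reverse ++ t))) b T' k) :
    TapeRuns (shift d i isStop back) T b T' (2 * xs.length + k) := by
  induction xs generalizing T t with
  | nil => simpa [← show T i = zip d s t from h] using h'
  | cons x xs ih =>
    refine (TapeRuns.iter_again (q' := ()) (runs_shiftStep_cons h (hxs x (by simp)))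
      (ih (t := x :: t) (by rw [Function.update_self]; rfl) (fun y hy => hxs y (by simp [hy])) ?_)).mono
      (by simp; omega)
    rw [Function.update_idem]
    simpa using h'

theorem shift_end {back : Bool} (h : T i = zip d xs t) (hxs : ∀ x ∈ xs, isStop x = false) :
    TapeRuns (shift d i isStop back) T false (Function.update T i (zip d [] (xs.reverse ++ t)))
      (2 * xs.length + 2) :=
  shift_of_forall (s := []) (by simpa using h) hxs
    (TapeRuns.iter_exit (runs_shiftStep_nil (by rw [Function.update_self])))

theorem shift_past (h : T i = zip d (xs ++ x :: s) t) (hxs : ∀ x ∈ xs, isStop x = false)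
    (hx : isStop x = true) :
    TapeRuns (shift d i isStop false) T true
      (Function.update T i (zip d s (x :: (xs.reverse ++ t)))) (2 * xs.length + 2) := by
  have := runs_shiftStep_past (T := Function.update T i (zip d (x :: s) (xs.reverse ++ t)))
    (by rw [Function.update_self]) hx
  rw [Function.update_idem] at this
  exact shift_of_forall h hxs (TapeRuns.iter_exit this)

theorem shift_before (h : T i = zip d (xs ++ x :: s) t) (hxs : ∀ x ∈ xs, isStop x = false)
    (hx : isStop x = true) :
    TapeRuns (shift d i isStop true) T true
      (Function.update T i (zip d (x :: s) (xs.reverse ++ t))) (2 * xs.length + 2) :=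
  shift_of_forall h hxs
    (TapeRuns.iter_exit (runs_shiftStep_before (by rw [Function.update_self]) hx))

end Shift

/-! ### Records -/

/-- A sentence of the language, a rule with one premise, a pair of an assumption and its contrary,
or a member of the candidate; the second field is empty for the first and the last kind. -/
structure Record where
  tag : Tag
  mark : Bool
  fst : Sentence
  snd : Sentence

def Sym.isTag : Sym → Bool
  | .tag _ _ => true
  | _ => false

/-- A sentence on a work tape. -/
def word (φ : Sentence) : List Sym := φ.map Sym.bit ++ [Sym.comma]

namespace Record

def head (r : Record) : Sym := .tag r.tag r.mark

def fields (r : Record) : List Sym := word r.fst ++ word r.snd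

def code (r : Record) : List Sym := r.head :: r.fields

/-- The first or the second field. -/
def field (r : Record) (f : Bool) : Sentence := if f then r.snd else r.fst

end Record

/-- A list of records on a work tape. -/
def codes (db : List Record) : List Sym := db.flatMap Record.code

theorem isTag_word {φ : Sentence} {x : Sym} (h : x ∈ word φ) : x.isTag = false := by
  simp only [word, List.mem_append, List.mem_map, List.mem_singleton] at h
  rcases h with ⟨b, -, rfl⟩ | rfl <;> rfl

theorem isTag_fields {r : Record} {x : Sym} (h : x ∈ r.fields) : x.isTag = false :=
  (List.mem_append.1 h).elim isTag_word isTag_word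

@[simp] theorem length_word (φ : Sentence) : (word φ).length = φ.length + 1 := by simp [word]

@[simp] theorem codes_cons (r : Record) (db : List Record) :
    codes (r :: db) = r.head :: (r.fields ++ codes db) := by simp [codes, Record.code]

theorem length_le_codes (db : List Record) : db.length ≤ (codes db).length := by
  induction db with
  | nil => simp
  | cons r db ih => simp; omega

/-! ### Comparison of fields -/

/-- `z'` is `z` with the head moved forward by at most `k` symbols, none of them a tag. -/
def Advance (k : ℕ) (z z' : Zipper) : Prop :=
  ∃ xs s, z.2 = xs ++ s ∧ z' = (xs.reverse ++ z.1, s) ∧ (∀ x ∈ xs, x.isTag = false) ∧ xs.length ≤ k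

theorem Advance.refl (k : ℕ) (z : Zipper) : Advance k z z := ⟨[], z.2, by simp⟩

theorem Advance.trans {k k' : ℕ} {z z' z'' : Zipper} (h : Advance k z z') (h' : Advance k' z' z'') :
    Advance (k + k') z z'' := by
  obtain ⟨xs, s, h₁, rfl, h₂, h₃⟩ := h
  obtain ⟨ys, s', rfl, rfl, h₄, h₅⟩ := h'
  refine ⟨xs ++ ys, s', by simp [h₁], by simp, fun x hx => ?_, by simp; omega⟩
  exact (List.mem_append.1 hx).elim (h₂ x) (h₄ x)

theorem Advance.mono {k k' : ℕ} {z z' : Zipper} (h : Advance k z z') (hk : k ≤ k') :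
    Advance k' z z' := by
  obtain ⟨xs, s, h₁, h₂, h₃, h₄⟩ := h
  exact ⟨xs, s, h₁, h₂, h₃, h₄.trans hk⟩

theorem Advance.cons {x : Sym} (hx : x.isTag = false) (l r : List Sym) :
    Advance 1 (l, x :: r) (x :: l, r) := ⟨[x], r, by simp [hx]⟩

/-- Return to the tag of the current record. -/
def toTag (i : Fin 4) : Prog Bool := shift false i Sym.isTag true

/-- No symbol passed by an `Advance` is a tag, so the first tag met on the way back is the one from
which the head set out. -/
theorem runs_toTag {i : Fin 4} {T : Tapes} {k : ℕ} {x : Sym} {l r : List Sym}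
    (h : Advance k (x :: l, r) (T i)) (hx : x.isTag = true) :
    TapeRuns (toTag i) T true (Function.update T i (x :: l, r)) (2 * k + 2) := by
  obtain ⟨xs, s, h₁, h₂, h₃, h₄⟩ := h
  have := shift_before (d := false) (i := i) (isStop := Sym.isTag) (T := T) (xs := xs.reverse)
    (s := l) (t := s) (x := x) h₂ (by simpa using h₃) hx
  have hz : zip false (x :: l) (xs.reverse.reverse ++ s) = (x :: l, r) := by
    rw [List.reverse_reverse, ← h₁]
    rfl
  rw [hz] at this
  exact this.mono (by simp; omega)

/-- Move to the field `f` of the current record. -/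
def toField (i : Fin 4) (f : Bool) : Prog Bool :=
  if f then shift true i (fun x => x = Sym.comma) false else Frag.pure true

/-- The new head position is left existential: the return by `runs_toTag` needs only a bound on the
distance and the absence of tags. -/
theorem runs_toField (i : Fin 4) (f : Bool) {T : Tapes} {r : Record} {l s : List Sym}
    (h : T i = (l, r.fields ++ s)) :
    ∃ l' s', Advance r.fields.length (T i) (l', word (r.field f) ++ s') ∧
      TapeRuns (toField i f) T true (Function.update T i (l', word (r.field f) ++ s'))
        (2 * r.fields.length + 2) := by
  cases f with
  | false =>
    refine ⟨l, word r.snd ++ s, ?_, ?_⟩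
    · rw [h]
      simpa [Record.field, Record.fields] using Advance.refl _ _
    · have : Function.update T i (l, word (r.field false) ++ (word r.snd ++ s)) = T := by
        rw [← List.append_assoc]
        exact (congrArg _ h.symm).trans (Function.update_eq_self _ _)
      rw [this]
      exact (TapeRuns.pure _).mono (by omega)
  | true =>
    refine ⟨(word r.fst).reverse ++ l, s, ?_, ?_⟩
    · rw [h]
      exact ⟨word r.fst, word r.snd ++ s, by simp [Record.fields], rfl, fun x => isTag_word,
        by simp [Record.fields]⟩
    · have := shift_past (d := true) (i := i) (isStop := fun x => x = Sym.comma) (T := T)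
        (xs := r.fst.map Sym.bit) (s := word r.snd ++ s) (t := l) (x := Sym.comma)
        (by simp [h, zip, Record.fields, word]) (by simp only [List.mem_map]; rintro _ ⟨b, -, rfl⟩; rfl)
        (by simp)
      have hz : zip true (word r.snd ++ s) (Sym.comma :: ((r.fst.map Sym.bit).reverse ++ l)) =
          ((word r.fst).reverse ++ l, word r.snd ++ s) := by simp [zip, word]
      rw [hz] at this
      exact this.mono (by simp [Record.fields]; omega)

/-- What to do after comparing two symbols. -/
def verdict (a b : Sym) : Unit ⊕ Bool :=
  if a = b then if a = Sym.comma then Sum.inr true else Sum.inl () else Sum.inr false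

/-- Compare the symbols behind the heads of two tapes, and move on. -/
def compareStep (i j : Fin 4) : Prog (Unit ⊕ Bool) :=
  (popTape true i).bind fun
    | none => Frag.pure (Sum.inr false)
    | some a => (popTape true j).bind fun
      | none => Frag.pure (Sum.inr false)
      | some b => (pushTape false i a).bind fun _ => (pushTape false j b).map fun _ => verdict a b

/-- Compare the sentences behind the heads of two tapes. -/
def compare (i j : Fin 4) : Prog Bool := Frag.iter (fun _ : Unit => compareStep i j) ()

section Compare

variable {i j : Fin 4} {T : Tapes} {a b : Sym} {l l' r r' : List Sym}

theorem runs_compareStep (hij : i ≠ j) (hi : T i = (l, a :: r)) (hj : T j = (l', b :: r')) :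
    TapeRuns (compareStep i j) T (verdict a b)
      (Function.update (Function.update T i (a :: l, r)) j (b :: l', r')) 4 := by
  have h₁ := runs_popTape (d := true) hi
  have h₂ := runs_popTape (d := true) (i := j) (T := Function.update T i (l, r))
    (s := b :: r') (t := l') (by rw [Function.update_of_ne hij.symm, hj]; rfl)
  have h₃ := runs_pushTape (d := false) (i := i)
    (T := Function.update (Function.update T i (l, r)) j (l', r')) a (s := l) (t := r)
    (by rw [Function.update_of_ne hij, Function.update_self]; rfl)
  have h₄ := (runs_pushTape (d := false) (i := j)
    (T := Function.update (Function.update (Function.update T i (l, r)) j (l', r')) i (a :: l, r))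
    b (s := l') (t := r')
    (by rw [Function.update_of_ne hij.symm, Function.update_self]; rfl)).map fun _ => verdict a b
  have hT : Function.update (Function.update T i (a :: l, r)) j (b :: l', r') =
      Function.update (Function.update (Function.update (Function.update T i (l, r)) j (l', r'))
        i (a :: l, r)) j (zip false (b :: l') r') := by
    funext k
    by_cases hk : k = j
    · subst hk
      simp [zip]
    · by_cases hk' : k = i
      · subst hk'
        simp [hk]
      · simp [hk, hk']
  rw [hT]
  refine TapeRuns.bind h₁ (t₂ := 3) ?_
  refine TapeRuns.bind h₂ (t₂ := 2) ?_
  exact TapeRuns.bind h₃ (t₂ := 1) h₄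

theorem update_update_of_ne (hij : i ≠ j) (T : Tapes) (z₁ z₂ z₃ z₄ : Zipper) :
    Function.update (Function.update (Function.update (Function.update T i z₁) j z₂) i z₃) j z₄ =
      Function.update (Function.update T i z₃) j z₄ := by
  funext k
  by_cases hk : k = j
  · simp [hk]
  · by_cases hk' : k = i
    · subst hk'
      simp [hk]
    · simp [hk, hk']

/-- Both sentences end in a comma, which does not occur inside them, so they agree iff the symbols
agree up to a common comma. A difference stops the comparison early, so only bounds on the head
positions are available. -/
theorem runs_compare (hij : i ≠ j) {u u' : Sentence} (hi : T i = (l, word u ++ r))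
    (hj : T j = (l', word u' ++ r')) :
    ∃ z z', Advance (u.length + 1) (T i) z ∧ Advance (u'.length + 1) (T j) z' ∧
      TapeRuns (compare i j) T (decide (u = u'))
        (Function.update (Function.update T i z) j z') (4 * (u.length + 1)) := by
  -- Every way of leaving the loop in a single round: a common comma or a first difference.
  have exit : ∀ {T : Tapes} {l l' s s' : List Sym} {a b : Sym} {k k' : ℕ} {e : Bool},
      T i = (l, a :: s) → T j = (l', b :: s') → a.isTag = false → b.isTag = false →
      verdict a b = Sum.inr e →
      ∃ z z', Advance (k + 1) (T i) z ∧ Advance (k' + 1) (T j) z' ∧ TapeRuns (compare i j) T e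
        (Function.update (Function.update T i z) j z') (4 * (k + 1)) := by
    intro T l l' s s' a b k k' e hi hj ha hb he
    have h := runs_compareStep hij hi hj
    rw [he] at h
    refine ⟨_, _, ?_, ?_, h.iter_exit.mono (by omega)⟩
    · rw [hi]; exact (Advance.cons ha _ _).mono (by omega)
    · rw [hj]; exact (Advance.cons hb _ _).mono (by omega)
  induction u generalizing T l l' u' with
  | nil =>
    cases u' with
    | nil => exact exit hi hj rfl rfl rfl
    | cons b u' => exact exit hi hj rfl rfl rfl
  | cons a u ih =>
    cases u' with
    | nil => exact exit hi hj rfl rfl rfl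
    | cons b u' =>
      by_cases hab : a = b
      · subst hab
        have h := runs_compareStep hij (r := word u ++ r) (r' := word u' ++ r') hi hj
        obtain ⟨z, z', hz, hz', hr⟩ := ih
          (T := Function.update (Function.update T i (.bit a :: l, word u ++ r)) j
            (.bit a :: l', word u' ++ r')) (u' := u')
          (by rw [Function.update_of_ne hij, Function.update_self]) (by rw [Function.update_self])
        rw [Function.update_of_ne hij, Function.update_self] at hz
        rw [Function.update_self] at hz'
        refine ⟨z, z', ?_, ?_, ?_⟩
        · rw [hi]
          exact ((Advance.cons rfl _ _).trans hz).mono (by simp; omega)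
        · rw [hj]
          exact ((Advance.cons rfl _ _).trans hz').mono (by simp; omega)
        · rw [update_update_of_ne hij] at hr
          simp only [verdict, if_true, reduceCtorEq, if_false] at h
          have := (TapeRuns.iter_again (q := ()) h hr).mono
            (t₁ := 4 * ((a :: u).length + 1)) (by simp; omega)
          simpa [compare] using this
      · exact exit hi hj rfl rfl (by simp [verdict, hab])

end Compare

/-- Compare a field of the current record of one tape with a field of that of another. -/
def sameField (i : Fin 4) (f : Bool) (j : Fin 4) (g : Bool) : Prog Bool :=
  (toField i f).bind fun _ => (toField j g).bind fun _ => (compare i j).bind fun b =>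
    (toTag i).bind fun _ => (toTag j).map fun _ => b

theorem length_field_le (r : Record) (f : Bool) : (r.field f).length + 1 ≤ r.fields.length := by
  cases f <;> simp [Record.field, Record.fields]

theorem runs_sameField {i j : Fin 4} (hij : i ≠ j) (f g : Bool) {T : Tapes} {r r' : Record}
    {l l' s s' : List Sym} {N : ℕ} (hi : T i = (r.head :: l, r.fields ++ s))
    (hj : T j = (r'.head :: l', r'.fields ++ s')) (hr : r.fields.length ≤ N)
    (hr' : r'.fields.length ≤ N) :
    TapeRuns (sameField i f j g) T (decide (r.field f = r'.field g)) T (16 * N + 8) := by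
  obtain ⟨l₁, s₁, ha₁, h₁⟩ := runs_toField i f hi
  obtain ⟨l₂, s₂, ha₂, h₂⟩ := runs_toField (T := Function.update T i (l₁, word (r.field f) ++ s₁))
    j g (by rw [Function.update_of_ne hij.symm, hj])
  obtain ⟨z, z', ha₃, ha₄, h₃⟩ := runs_compare hij
    (T := Function.update (Function.update T i (l₁, word (r.field f) ++ s₁)) j
      (l₂, word (r'.field g) ++ s₂))
    (by rw [Function.update_of_ne hij, Function.update_self]) (by rw [Function.update_self])
  rw [update_update_of_ne hij] at h₃
  rw [Function.update_of_ne hij, Function.update_self] at ha₃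
  rw [Function.update_self] at ha₄
  rw [Function.update_of_ne hij.symm] at ha₂
  have hl := length_field_le r f
  have hl' := length_field_le r' g
  -- The distance `2 * N` is at most `N` for reaching the field plus at most `N` for reading it.
  have h₄ := runs_toTag (i := i) (T := Function.update (Function.update T i z) j z')
    (k := 2 * N) (x := r.head) (l := l) (r := r.fields ++ s)
    (by
      rw [Function.update_of_ne hij, Function.update_self, ← hi]
      exact (ha₁.trans ha₃).mono (by omega)) rfl
  rw [← hi, show Function.update (Function.update (Function.update T i z) j z') i (T i) =
      Function.update T j z' by
    rw [Function.update_comm hij, Function.update_idem, Function.update_comm hij.symm,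
      Function.update_eq_self]] at h₄
  have h₅ := (runs_toTag (i := j) (T := Function.update T j z')
    (k := 2 * N) (x := r'.head) (l := l') (r := r'.fields ++ s')
    (by
      rw [Function.update_self, ← hj]
      exact (ha₂.trans ha₄).mono (by omega)) rfl).map
        fun _ => decide (r.field f = r'.field g)
  rw [Function.update_idem, ← hj, Function.update_eq_self] at h₅
  have h₆ : TapeRuns (sameField i f j g) T _ T _ :=
    h₁.bind (h₂.bind (h₃.bind (h₄.bind h₅)))
  exact h₆.mono (by omega)

end ABA


/-! ### First-order conditions on a list of records, decided in polynomial time -/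

namespace ABA

/-- Tapes below `n` stand at the current records `v`, the others at the beginning of `db`. -/
def Ready (db : List Record) (n : ℕ) (v : Fin 4 → Record) (T : Tapes) : Prop :=
  (∀ i : Fin 4, i.val < n → ∃ l s, T i = ((v i).head :: l, (v i).fields ++ s)) ∧
    ∀ i : Fin 4, n ≤ i.val → T i = ([], codes db)

/-- A program that decides a property of a list of records and of the first `n` variables in
polynomial time, and leaves the tapes as they were. -/
structure Test (n : ℕ) (P : List Record → (Fin 4 → Record) → Prop) where
  prog : Prog Bool
  time : Polynomial ℕ
  spec : ∀ {db v T N}, Ready db n v T → (codes db).length ≤ N →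
    (∀ i : Fin 4, i.val < n → (v i).fields.length ≤ N) →
    ∃ b, (b = true ↔ P db v) ∧ TapeRuns prog T b T (time.eval N)

namespace Test

variable {n : ℕ} {P Q : List Record → (Fin 4 → Record) → Prop}

/-- A test of an equivalent property. -/
def congr (F : Test n P) (h : ∀ db v, P db v ↔ Q db v) : Test n Q where
  prog := F.prog
  time := F.time
  spec h₁ h₂ h₃ :=
    let ⟨b, hb, hr⟩ := F.spec h₁ h₂ h₃
    ⟨b, hb.trans (h _ _), hr⟩

/-- Negation. -/
def not (F : Test n P) : Test n fun db v => ¬ P db v where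
  prog := F.prog.map (!·)
  time := F.time
  spec h₁ h₂ h₃ :=
    let ⟨b, hb, hr⟩ := F.spec h₁ h₂ h₃
    ⟨!b, by rw [← hb]; simp, hr.map _⟩

/-- Conjunction. -/
noncomputable def and (F : Test n P) (G : Test n Q) : Test n fun db v => P db v ∧ Q db v where
  prog := F.prog.bind fun b => if b then G.prog else Frag.pure false
  time := F.time + G.time + 1
  spec h₁ h₂ h₃ := by
    obtain ⟨b, hb, hr⟩ := F.spec h₁ h₂ h₃
    obtain ⟨c, hc, hs⟩ := G.spec h₁ h₂ h₃
    simp only [Polynomial.eval_add, Polynomial.eval_one]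
    cases b with
    | false =>
      refine ⟨false, by simp [← hb], ?_⟩
      have h : TapeRuns (F.prog.bind fun b => if b then G.prog else Frag.pure false) _ false _ _ :=
        TapeRuns.bind hr (TapeRuns.pure false)
      exact h.mono (by omega)
    | true => exact ⟨c, by simp [← hb, hc], (TapeRuns.bind hr hs).mono (by omega)⟩

/-- Disjunction. -/
noncomputable def or (F : Test n P) (G : Test n Q) : Test n fun db v => P db v ∨ Q db v :=
  (F.not.and G.not).not.congr fun _ _ => by tauto

/-- Implication. -/
noncomputable def imp (F : Test n P) (G : Test n Q) : Test n fun db v => P db v → Q db v :=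
  (F.and G.not).not.congr fun _ _ => by tauto

/-- A property of the tag and the mark of a current record. -/
noncomputable def head (i : Fin 4) (p : Sym → Bool) (hi : i.val < n := by decide) :
    Test n fun _ v => p (v i).head = true where
  prog := (popTape false i).bind fun
    | none => Frag.pure false
    | some x => (pushTape false i x).map fun _ => p x
  time := 2
  spec {db v T N} h₁ h₂ h₃ := by
    obtain ⟨l, s, h⟩ := h₁.1 i hi
    have h₄ := runs_popTape (d := false) h
    have h₅ := (runs_pushTape (d := false) (i := i) (T := Function.update T i (l, (v i).fields ++ s))
      (v i).head (s := l) (t := (v i).fields ++ s) (by rw [Function.update_self]; rfl)).map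
        fun _ => p (v i).head
    have hz : zip false ((v i).head :: l) ((v i).fields ++ s) = T i := h.symm
    rw [Function.update_idem, hz, Function.update_eq_self] at h₅
    refine ⟨p (v i).head, Iff.rfl, ?_⟩
    exact (TapeRuns.bind h₄ h₅).mono (by simp)

/-- The tag of a current record. -/
noncomputable def tag (i : Fin 4) (t : Tag) (hi : i.val < n := by decide) :
    Test n fun _ v => (v i).tag = t :=
  (head i (fun | .tag t' _ => t' = t | _ => false) hi).congr fun _ _ => by simp [Record.head]

/-- The mark of a current record. -/
noncomputable def mark (i : Fin 4) (hi : i.val < n := by decide) :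
    Test n fun _ v => (v i).mark = true :=
  (head i (fun | .tag _ m => m | _ => false) hi).congr fun _ _ => by simp [Record.head]

/-- Equality of fields of two current records. -/
noncomputable def eq (i : Fin 4) (f : Bool) (j : Fin 4) (g : Bool) (hij : i ≠ j := by decide)
    (hi : i.val < n := by decide) (hj : j.val < n := by decide) :
    Test n fun _ v => (v i).field f = (v j).field g where
  prog := sameField i f j g
  time := 16 * Polynomial.X + 8
  spec {db v T N} h₁ h₂ h₃ := by
    obtain ⟨l, s, h⟩ := h₁.1 i hi
    obtain ⟨l', s', h'⟩ := h₁.1 j hj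
    exact ⟨_, decide_eq_true_iff,
      (runs_sameField hij f g h h' (h₃ i hi) (h₃ j hj)).mono (by simp)⟩

end Test

/-- Move tape `i` back to its beginning. -/
def rewind (i : Fin 4) : Prog Bool := shift false i (fun _ => false) false

/-- Move tape `i` to the next record. -/
def next (i : Fin 4) : Prog Bool := shift true i Sym.isTag false

section Loop

variable {i : Fin 4} {T : Tapes} {l s xs : List Sym}

theorem runs_rewind (h : T i = (l, s)) :
    TapeRuns (rewind i) T false (Function.update T i ([], l.reverse ++ s)) (2 * l.length + 2) :=
  shift_end (d := false) h (by simp)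

theorem runs_next_cons {r : Record} {db : List Record} (h : T i = (l, xs ++ codes (r :: db)))
    (hxs : ∀ x ∈ xs, x.isTag = false) :
    TapeRuns (next i) T true
      (Function.update T i (r.head :: (xs.reverse ++ l), r.fields ++ codes db))
      (2 * xs.length + 2) :=
  shift_past (d := true) (x := r.head) (s := r.fields ++ codes db) (t := l)
    (by rw [h, codes_cons]; rfl) hxs rfl

theorem runs_next_nil (h : T i = (l, xs)) (hxs : ∀ x ∈ xs, x.isTag = false) :
    TapeRuns (next i) T false (Function.update T i (xs.reverse ++ l, [])) (2 * xs.length + 2) :=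
  shift_end (d := true) h hxs

/-- One round of the search for a record: move to the next one and test it. -/
def searchStep (i : Fin 4) (F : Prog Bool) : Prog (Unit ⊕ Bool) :=
  (next i).bind fun found =>
    if found then F.bind fun b =>
      if b then (rewind i).map fun _ => Sum.inr true else Frag.pure (Sum.inl ())
    else (rewind i).map fun _ => Sum.inr false

/-- Search tape `i` for a record that satisfies `F`. -/
def search (i : Fin 4) (F : Prog Bool) : Prog Bool :=
  Frag.iter (fun _ : Unit => searchStep i F) ()

variable {P : List Record → (Fin 4 → Record) → Prop}

theorem Ready.update {db : List Record} {v : Fin 4 → Record} (h : Ready db i v T) (r : Record)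
    (l s : List Sym) :
    Ready db (i + 1) (Function.update v i r)
      (Function.update T i (r.head :: l, r.fields ++ s)) := by
  refine ⟨fun j hj => ?_, fun j hj => ?_⟩
  · by_cases hji : j = i
    · subst hji
      exact ⟨l, s, by simp⟩
    · have hlt : j.val < i.val := by omega
      obtain ⟨l', s', h'⟩ := h.1 j hlt
      exact ⟨l', s', by rw [Function.update_of_ne hji, Function.update_of_ne hji, h']⟩
  · have hji : j ≠ i := by rintro rfl; omega
    rw [Function.update_of_ne hji]
    exact h.2 j (by omega)

/-- Induction on the records `post` still ahead of the head; `l` has been passed, and `xs` is the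
rest of the current record, empty at the start. Both exits rewind, so the outer variables find the
tapes unchanged. -/
theorem runs_search (F : Test (i + 1) P) {db : List Record} {v : Fin 4 → Record} {N : ℕ}
    (h₁ : Ready db i v T) (h₂ : (codes db).length ≤ N)
    (h₃ : ∀ j : Fin 4, j.val < i.val → (v j).fields.length ≤ N) {post : List Record}
    (hdb : l.reverse ++ xs ++ codes post = codes db) (hpost : post ⊆ db)
    (hxs : ∀ x ∈ xs, x.isTag = false) :
    ∃ b, (b = true ↔ ∃ r ∈ post, P db (Function.update v i r)) ∧
      TapeRuns (search i F.prog) (Function.update T i (l, xs ++ codes post)) b T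
        ((post.length + 1) * (F.time.eval N + 4 * N + 6)) := by
  -- Tape `i` is not yet in use in `T`, so it stands at its beginning there, and rewinding it gives
  -- back `T`.
  have hback : Function.update T i ([], codes db) = T := by
    rw [← h₁.2 i le_rfl, Function.update_eq_self]
  induction post generalizing l xs with
  | nil =>
    rw [codes, List.flatMap_nil, List.append_nil] at hdb ⊢
    have h₄ := runs_next_nil (T := Function.update T i (l, xs)) (by rw [Function.update_self]) hxs
    rw [Function.update_idem] at h₄
    have h₅ := (runs_rewind (T := Function.update T i (xs.reverse ++ l, []))
      (by rw [Function.update_self])).map fun _ => (Sum.inr false : Unit ⊕ Bool)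
    rw [Function.update_idem, List.append_nil, List.reverse_append, List.reverse_reverse, hdb,
      hback] at h₅
    have h₆ : TapeRuns (searchStep i F.prog) _ _ _ _ := TapeRuns.bind h₄ h₅
    refine ⟨false, by simp, h₆.iter_exit.mono ?_⟩
    have := congrArg List.length hdb
    simp only [List.length_append, List.length_reverse] at this ⊢
    simp only [List.length_nil]
    omega
  | cons r post ih =>
    have h₄ := runs_next_cons (T := Function.update T i (l, xs ++ codes (r :: post)))
      (by rw [Function.update_self]) hxs
    rw [Function.update_idem] at h₄
    have hlen := congrArg List.length hdb
    simp only [codes_cons, List.length_append, List.length_reverse, List.length_cons] at hlen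
    obtain ⟨b, hb, hF⟩ := F.spec (h₁.update r (xs.reverse ++ l) (codes post)) h₂ (fun j hj => by
      by_cases hji : j = i
      · subst hji
        rw [Function.update_self]
        omega
      · rw [Function.update_of_ne hji]
        exact h₃ j (by omega))
    have hdb' : (r.head :: (xs.reverse ++ l)).reverse ++ r.fields ++ codes post = codes db := by
      rw [← hdb]
      simp
    cases b with
    | true =>
      have h₅ := (runs_rewind (T := Function.update T i
        (r.head :: (xs.reverse ++ l), r.fields ++ codes post))
        (by rw [Function.update_self])).map fun _ => (Sum.inr true : Unit ⊕ Bool)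
      rw [Function.update_idem, ← List.append_assoc, hdb', hback] at h₅
      have h₆ : TapeRuns (searchStep i F.prog) _ _ _ _ := TapeRuns.bind h₄ (TapeRuns.bind hF h₅)
      refine ⟨true, iff_of_true rfl ⟨r, by simp, hb.1 rfl⟩, h₆.iter_exit.mono ?_⟩
      -- A hit ends the search, so the cost of a single round is all that is needed.
      refine le_trans ?_ (Nat.le_mul_of_pos_left _ (Nat.succ_pos _))
      simp only [List.length_append, List.length_reverse, List.length_cons]
      omega
    | false =>
      have h₅ : TapeRuns (searchStep i F.prog) _ _ _ _ :=
        TapeRuns.bind h₄ (TapeRuns.bind hF (TapeRuns.pure (Sum.inl ())))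
      obtain ⟨c, hc, h₆⟩ := ih (l := r.head :: (xs.reverse ++ l)) (xs := r.fields) hdb'
        (fun x hx => hpost (by simp [hx])) fun x => isTag_fields
      refine ⟨c, ?_, (TapeRuns.iter_again h₅ h₆).mono ?_⟩
      · have : ¬ P db (Function.update v i r) := fun h => by simpa using hb.2 h
        simp [hc, this]
      · rw [List.length_cons, Nat.add_mul (post.length + 1)]
        omega

end Loop

namespace Test

variable {n : ℕ} {P : List Record → (Fin 4 → Record) → Prop}

/-- Existential quantification over the records. -/
noncomputable def ex (i : Fin 4) (F : Test (n + 1) P) (hn : i.val = n := by rfl) :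
    Test n fun db v => ∃ r ∈ db, P db (Function.update v i r) where
  prog := search i F.prog
  -- At most `N` records are visited, since each has a nonempty code, and one more round finds the
  -- end.
  time := (Polynomial.X + 1) * (F.time + 4 * Polynomial.X + 6)
  spec {db v T N} h₁ h₂ h₃ := by
    subst hn
    obtain ⟨b, hb, hr⟩ := runs_search F h₁ h₂ h₃ (l := []) (xs := []) (post := db) rfl
      (fun _ h => h) (by simp)
    refine ⟨b, hb, ?_⟩
    have hT : Function.update T i ([], [] ++ codes db) = T := by
      rw [List.nil_append, ← h₁.2 i le_rfl, Function.update_eq_self]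
    rw [hT] at hr
    refine hr.mono ?_
    simp only [Polynomial.eval_mul, Polynomial.eval_add, Polynomial.eval_X, Polynomial.eval_one,
      Polynomial.eval_ofNat]
    exact Nat.mul_le_mul_right _ (by have := length_le_codes db; omega)

/-- Existential quantification over the records with tag `t`. -/
noncomputable def exTag (i : Fin 4) (t : Tag) (F : Test (n + 1) P) (hn : i.val = n := by rfl) :
    Test n fun db v => ∃ r ∈ db, r.tag = t ∧ P db (Function.update v i r) :=
  (((tag i t (hn ▸ Nat.lt_succ_self _)).and F).ex i hn).congr fun _ _ => by simp

/-- Universal quantification over the records with tag `t`. -/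
noncomputable def allTag (i : Fin 4) (t : Tag) (F : Test (n + 1) P) (hn : i.val = n := by rfl) :
    Test n fun db v => ∀ r ∈ db, r.tag = t → P db (Function.update v i r) :=
  (F.not.exTag i t hn).not.congr fun _ _ => by simp

end Test

end ABA


/-! ### Rounds of marking, and their repetition -/

namespace ABA

/-- Tapes that agree except that the first may have symbols before the head. -/
def spread (l s : List Sym) : Tapes := fun i => (if i = 0 then l else [], s)

/-- The record with its mark set. -/
def Record.marked (r : Record) : Record := { r with mark := true }

open Classical in
/-- Mark the records of `db` that satisfy `P`. -/
noncomputable def markAll (P : List Record → (Fin 4 → Record) → Prop) (db : List Record) :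
    List Record :=
  db.map fun r => if P db (fun _ => r) then r.marked else r

section Mark

variable {P : List Record → (Fin 4 → Record) → Prop}

/-- Set the mark of the current record of the first tape. -/
def setMark : Prog Unit :=
  (popTape false 0).bind fun
    | some (.tag t _) => pushTape false 0 (.tag t true)
    | _ => Frag.pure ()

theorem runs_setMark {T : Tapes} {r : Record} {l s : List Sym} (h : T 0 = (r.head :: l, s)) :
    TapeRuns setMark T () (Function.update T 0 (r.marked.head :: l, s)) 2 := by
  have h₁ := runs_popTape (d := false) h
  have h₂ := runs_pushTape (d := false) (i := 0) (T := Function.update T 0 (l, s)) r.marked.head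
    (s := l) (t := s) (by rw [Function.update_self]; rfl)
  rw [Function.update_idem] at h₂
  rw [List.head?_cons] at h₁
  exact TapeRuns.bind h₁ (t₂ := 1) h₂

/-- Move to the next record of the first tape, and mark it if it satisfies `F`. -/
def markStep (F : Prog Bool) : Prog (Unit ⊕ Unit) :=
  (next 0).bind fun found =>
    if found then F.bind fun b =>
      if b then setMark.map Sum.inl else Frag.pure (Sum.inl ())
    else Frag.pure (Sum.inr ())

/-- Mark the records of the first tape that satisfy `F`. -/
def markPass (F : Prog Bool) : Prog Unit := Frag.iter (fun _ : Unit => markStep F) ()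

/-- Only the current record of tape 0 matters, not what surrounds it; a test of one variable thus
remains applicable while tape 0 is being rewritten. -/
theorem Ready.one {db : List Record} {T : Tapes} (h : ∀ i : Fin 4, 1 ≤ i.val → T i = ([], codes db))
    (r : Record) (l s : List Sym) :
    Ready db 1 (fun _ => r) (Function.update T 0 (r.head :: l, r.fields ++ s)) := by
  refine ⟨fun i hi => ?_, fun i hi => ?_⟩
  · obtain rfl : i = 0 := by omega
    exact ⟨l, s, by simp⟩
  · rw [Function.update_of_ne (by rintro rfl; simp at hi)]
    exact h i hi

-- Quantifiers inside the test scan tapes 1 to 3, which keep the old list during the whole pass. All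
-- records are therefore judged by the same `db`, and marks set in this round are not yet visible.
open Classical in
theorem runs_markPass (F : Test 1 P) {db : List Record} {N : ℕ} {T : Tapes}
    (h₁ : ∀ i : Fin 4, 1 ≤ i.val → T i = ([], codes db)) (h₂ : (codes db).length ≤ N)
    {post : List Record} {l xs : List Sym} (hxs : ∀ x ∈ xs, x.isTag = false)
    (h₃ : (xs ++ codes post).length ≤ N) :
    TapeRuns (markPass F.prog) (Function.update T 0 (l, xs ++ codes post)) ()
      (Function.update T 0 ((codes (post.map fun r =>
        if P db (fun _ => r) then r.marked else r)).reverse ++ (xs.reverse ++ l), []))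
      ((post.length + 1) * (F.time.eval N + 2 * N + 5)) := by
  induction post generalizing l xs with
  | nil =>
    rw [codes, List.flatMap_nil, List.append_nil] at h₃ ⊢
    have h₄ := runs_next_nil (T := Function.update T 0 (l, xs)) (by rw [Function.update_self]) hxs
    rw [Function.update_idem] at h₄
    have h₅ : TapeRuns (markStep F.prog) _ _ _ _ := TapeRuns.bind h₄ (TapeRuns.pure (Sum.inr ()))
    refine h₅.iter_exit.mono ?_
    simp only [List.length_nil]
    omega
  | cons r post ih =>
    have h₄ := runs_next_cons (T := Function.update T 0 (l, xs ++ codes (r :: post)))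
      (by rw [Function.update_self]) hxs
    rw [Function.update_idem] at h₄
    simp only [codes_cons, List.length_append, List.length_cons] at h₃
    obtain ⟨b, hb, hF⟩ := F.spec (Ready.one h₁ r (xs.reverse ++ l) (codes post)) h₂
      (fun j hj => show r.fields.length ≤ N by omega)
    -- Both answers of the test are brought to one form, with `r'` the record left behind, so that
    -- the induction continues in one way.
    have key : ∃ r' : Record, r' = (if P db (fun _ => r) then r.marked else r) ∧
        TapeRuns (markStep F.prog) (Function.update T 0 (l, xs ++ codes (r :: post))) (Sum.inl ())
          (Function.update T 0 (r'.head :: (xs.reverse ++ l), r.fields ++ codes post))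
          (2 * xs.length + 2 + (F.time.eval N + 2)) := by
      cases b with
      | true =>
        refine ⟨r.marked, by rw [if_pos (hb.1 rfl)], ?_⟩
        have h₅ := runs_setMark (T := Function.update T 0
          (r.head :: (xs.reverse ++ l), r.fields ++ codes post)) (by rw [Function.update_self])
        rw [Function.update_idem] at h₅
        exact TapeRuns.bind h₄ (TapeRuns.bind hF (h₅.map Sum.inl))
      | false =>
        refine ⟨r, by rw [if_neg (fun h => by simpa using hb.2 h)], ?_⟩
        have h₅ : TapeRuns (markStep F.prog) _ _ _ _ :=
          TapeRuns.bind h₄ (TapeRuns.bind hF (TapeRuns.pure (Sum.inl ())))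
        exact h₅.mono (by omega)
    obtain ⟨r', hr', h₅⟩ := key
    have h₆ := ih (l := r'.head :: (xs.reverse ++ l)) (xs := r.fields) (fun x => isTag_fields)
      (by rw [List.length_append]; omega)
    have hf : r'.fields = r.fields := by rw [hr']; split_ifs <;> rfl
    have h₇ : TapeRuns (markPass F.prog) _ _ _ _ := TapeRuns.iter_again h₅ h₆
    rw [List.map_cons, ← hr', codes_cons r', hf]
    simp only [List.reverse_cons, List.reverse_append, List.append_assoc, List.singleton_append]
    refine h₇.mono ?_
    rw [List.length_cons, Nat.add_mul (post.length + 1)]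
    omega

end Mark

/-- Put a symbol behind the heads of all tapes. -/
def pushAll (a : Sym) : Prog Unit :=
  (pushTape true 0 a).bind fun _ => (pushTape true 1 a).bind fun _ =>
    (pushTape true 2 a).bind fun _ => pushTape true 3 a

theorem runs_pushAll (a : Sym) (l s : List Sym) :
    TapeRuns (pushAll a) (spread l s) () (spread l (a :: s)) 4 := by
  have h₀ := runs_pushTape (d := true) (i := 0) (T := spread l s) a (s := s) (t := l) rfl
  have h₁ := runs_pushTape (d := true) (i := 1) (T := Function.update (spread l s) 0 (l, a :: s)) a
    (s := s) (t := []) rfl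
  have h₂ := runs_pushTape (d := true) (i := 2)
    (T := Function.update (Function.update (spread l s) 0 (l, a :: s)) 1 ([], a :: s)) a
    (s := s) (t := []) rfl
  have h₃ := runs_pushTape (d := true) (i := 3)
    (T := Function.update (Function.update (Function.update (spread l s) 0 (l, a :: s))
      1 ([], a :: s)) 2 ([], a :: s)) a
    (s := s) (t := []) rfl
  have h : TapeRuns (pushAll a) _ _ _ _ :=
    TapeRuns.bind h₀ (TapeRuns.bind h₁ (TapeRuns.bind h₂ h₃))
  convert h using 1
  funext i
  fin_cases i <;> rfl

/-- Move a symbol before the head of the first tape behind the heads of all tapes. -/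
def distributeStep : Prog (Unit ⊕ Unit) :=
  (popTape false 0).bind fun
    | some a => (pushAll a).map Sum.inl
    | none => Frag.pure (Sum.inr ())

/-- Move all that is before the head of the first tape behind the heads of all tapes. -/
def distribute : Prog Unit := Frag.iter (fun _ : Unit => distributeStep) ()

/-- Popping reverses the order, so symbols stored in reverse before the head come out in their
proper order. Each costs one pop and four pushes. -/
theorem runs_distribute (l s : List Sym) :
    TapeRuns distribute (spread l s) () (spread [] (l.reverse ++ s)) (5 * l.length + 2) := by
  induction l generalizing s with
  | nil =>
    have h := runs_popTape (d := false) (i := 0) (T := spread [] s) (s := []) (t := s) rfl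
    have hT : Function.update (spread [] s) 0 (zip false [] s) = spread [] s :=
      Function.update_eq_self 0 (spread [] s)
    rw [List.tail_nil, hT] at h
    have h' : TapeRuns distributeStep _ _ _ _ := TapeRuns.bind h (TapeRuns.pure (Sum.inr ()))
    exact h'.iter_exit
  | cons a l ih =>
    have h := runs_popTape (d := false) (i := 0) (T := spread (a :: l) s) (s := a :: l) (t := s) rfl
    have hT : Function.update (spread (a :: l) s) 0 (zip false l s) = spread l s := by
      funext i
      by_cases hi : i = 0
      · subst hi
        simp [spread, zip]
      · simp [spread, hi]
    rw [List.tail_cons, hT] at h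
    have h' : TapeRuns distributeStep _ _ _ _ :=
      TapeRuns.bind h ((runs_pushAll a l s).map Sum.inl)
    have := TapeRuns.iter_again (q := ()) h' (ih (a :: s))
    rw [List.reverse_cons, List.append_assoc]
    exact this.mono (by simp; omega)

/-- Empty a stack. -/
def erase (k : Stack) : Prog Unit :=
  Frag.clear (Γ := Alphabet) k (fun _ a => (none, none, a.isSome)) fun v => v.2.2

theorem runs_erase (k : Stack) (S : ∀ k, List (Alphabet k)) :
    (erase k).Runs S () (Function.update S k []) ((S k).length + 1) :=
  Frag.runs_clear k (fun _ a => (none, none, a.isSome)) (fun v => v.2.2) (fun _ _ => rfl) S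

theorem runs_erase_tape (d : Bool) (i : Fin 4) {T : Tapes} {s t : List Sym} (h : T i = zip d s t) :
    TapeRuns (erase (.tape d i)) T () (Function.update T i (zip d [] t)) (s.length + 1) := by
  intro w o n
  have := runs_erase (.tape d i) (layout w o n T)
  rwa [update_layout_tape _ _ _ _ _ _ h, layout_tape _ _ _ _ _ _ h] at this

/-- Mark the records that satisfy `F`, on all tapes. -/
def round (F : Prog Bool) : Prog Unit :=
  (markPass F).bind fun _ => (erase (.tape true 1)).bind fun _ => (erase (.tape true 2)).bind fun _ =>
    (erase (.tape true 3)).bind fun _ => distribute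

section Rounds

variable {P : List Record → (Fin 4 → Record) → Prop}

/-- A mark is the flag inside a tag symbol, so marking replaces symbols one for one. The bound on
the tape length hence survives any number of rounds. -/
theorem length_codes_markAll (db : List Record) :
    (codes (markAll P db)).length = (codes db).length := by
  classical
  have : ∀ Q : Record → Prop, (codes (db.map fun r => if Q r then r.marked else r)).length =
      (codes db).length := by
    intro Q
    induction db with
    | nil => rfl
    | cons r db ih =>
      have hf : (if Q r then r.marked else r).fields = r.fields := by split_ifs <;> rfl
      simp [ih, hf]
  exact this _

/-- After the pass tape 0 holds the new list in reverse and the other three hold stale copies.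
Erasing these costs at most `3 * (N + 1)` and redistributing `5 * N + 2`, which gives the summand `8
* N + 5`. -/
theorem runs_round (F : Test 1 P) {db : List Record} {N : ℕ} (h : (codes db).length ≤ N) :
    TapeRuns (round F.prog) (spread [] (codes db)) () (spread [] (codes (markAll P db)))
      ((N + 1) * (F.time.eval N + 2 * N + 5) + (8 * N + 5)) := by
  have h₁ := runs_markPass F (T := spread [] (codes db)) (N := N) (post := db) (l := []) (xs := [])
    (fun i hi => by simp [spread]) h (by simp) h
  have hT : Function.update (spread [] (codes db)) 0 ([], [] ++ codes db) = spread [] (codes db) :=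
    Function.update_eq_self 0 (spread [] (codes db))
  rw [hT, List.reverse_nil, List.nil_append, List.append_nil] at h₁
  set l := (codes (markAll P db)).reverse with hl
  change TapeRuns _ _ () (Function.update (spread [] (codes db)) 0 (l, [])) _ at h₁
  have h₂ := runs_erase_tape true 1 (T := Function.update (spread [] (codes db)) 0 (l, []))
    (s := codes db) (t := []) rfl
  have h₃ := runs_erase_tape true 2
    (T := Function.update (Function.update (spread [] (codes db)) 0 (l, [])) 1 ([], []))
    (s := codes db) (t := []) rfl
  have h₄ := runs_erase_tape true 3
    (T := Function.update (Function.update (Function.update (spread [] (codes db)) 0 (l, []))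
      1 ([], [])) 2 ([], [])) (s := codes db) (t := []) rfl
  have hT' : Function.update (Function.update (Function.update (Function.update
      (spread [] (codes db)) 0 (l, [])) 1 ([], [])) 2 ([], [])) 3 (zip true [] []) =
      spread l [] := by
    funext i
    fin_cases i <;> rfl
  rw [hT'] at h₄
  have h₅ := runs_distribute l []
  rw [hl, List.reverse_reverse, List.append_nil, ← hl] at h₅
  have h₆ : TapeRuns (round F.prog) _ _ _ _ :=
    TapeRuns.bind h₁ (TapeRuns.bind h₂ (TapeRuns.bind h₃ (TapeRuns.bind h₄ h₅)))
  refine h₆.mono ?_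
  have hlen : l.length = (codes db).length := by rw [hl, List.length_reverse, length_codes_markAll]
  have : (db.length + 1) * (F.time.eval N + 2 * N + 5) ≤ (N + 1) * (F.time.eval N + 2 * N + 5) :=
    Nat.mul_le_mul_right _ (by have := length_le_codes db; omega)
  omega

/-- Take a symbol off the counter. -/
def popCounter : Prog Bool :=
  Frag.pop (Γ := Alphabet) .cnt (fun _ a => (none, none, a.isSome)) fun v => v.2.2

theorem runs_popCounter (w o n T) :
    popCounter.Runs (layout w o n T) (decide (0 < n)) (layout w o (n - 1) T) 1 := by
  have h := Frag.runs_pop (Γ := Alphabet) (σ := Reg) .cnt (fun _ a => (none, none, a.isSome))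
    (fun v => v.2.2) (layout w o n T) (decide (0 < n)) (fun v => by
      cases n <;> simp [layout, List.replicate_succ])
  suffices hS : layout w o (n - 1) T = Function.update (layout w o n T) .cnt
      (layout w o n T .cnt).tail by
    rw [hS]
    exact h
  funext k
  by_cases hk : k = .cnt
  · subst hk
    simp [layout]
  · rw [Function.update_of_ne hk]
    rcases k with _ | _ | _ | ⟨d, i⟩
    · rfl
    · rfl
    · exact absurd rfl hk
    · cases d <;> rfl

/-- Repeat a program as often as the counter says. -/
def repeatProg (F : Prog Unit) : Prog Unit :=
  Frag.iter (fun _ : Unit => popCounter.bind fun b =>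
    if b then F.map Sum.inl else Frag.pure (Sum.inr ())) ()

theorem runs_repeatProg (F : Test 1 P) {N : ℕ} (w o) {n : ℕ} {db : List Record}
    (h : (codes db).length ≤ N) :
    (repeatProg (round F.prog)).Runs (layout w o n (spread [] (codes db))) ()
      (layout w o 0 (spread [] (codes ((markAll P)^[n] db))))
      ((n + 1) * ((N + 1) * (F.time.eval N + 2 * N + 5) + (8 * N + 5) + 2)) := by
  induction n generalizing db with
  | zero =>
    have h₁ := runs_popCounter w o 0 (spread [] (codes db))
    have h₂ := Frag.Runs.bind h₁ (Frag.runs_pure (Sum.inr () : Unit ⊕ Unit) _)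
      (G := fun b => if b then (round F.prog).map Sum.inl else Frag.pure (Sum.inr ()))
    exact (Frag.Runs.iter_exit (q := ()) h₂).mono (by omega)
  | succ n ih =>
    have h₁ := runs_popCounter w o (n + 1) (spread [] (codes db))
    have h₂ := ((runs_round F h) w o n).map (Sum.inl : Unit → Unit ⊕ Unit)
    have hn : decide (0 < n + 1) = true := by simp
    rw [hn] at h₁
    have h₃ := Frag.Runs.bind h₁ h₂
      (G := fun b => if b then (round F.prog).map Sum.inl else Frag.pure (Sum.inr ()))
    -- The same `N` serves for the marked list, whose code has the same length.
    have h₄ := ih (db := markAll P db) (by rwa [length_codes_markAll])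
    have h₅ : (repeatProg (round F.prog)).Runs _ _ _ _ := Frag.Runs.iter_again h₃ h₄
    refine h₅.mono ?_
    rw [Nat.add_mul (n + 1)]
    omega

end Rounds

end ABA


namespace ABA

/-! ### Parsing -/

/-- The position of the parser within a section of the input. -/
inductive Phase
  | start
  | first
  | second
  | finished
  deriving DecidableEq

instance : Finite Phase := by
  have : Fintype Phase :=
    ⟨{Phase.start, Phase.first, Phase.second, Phase.finished}, by intro x; cases x <;> simp⟩
  exact Finite.of_fintype _

namespace Tag

/-- What follows the first sentence of an item. -/
def afterFirst : Tag → Phase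
  | lang | cand => .start
  | rule | contr => .second

/-- What follows the second sentence of an item. -/
def afterSecond : Tag → Phase
  | rule => .finished
  | _ => .start

/-- The empty second field of items that are single sentences. -/
def pad : Tag → List Sym
  | lang | cand => [.comma]
  | rule | contr => []

/-- The section that follows the given one. -/
def next : Tag → Option Tag
  | lang => some rule
  | rule => some contr
  | contr => some cand
  | cand => none

end Tag

/-- The parser is in a section, or has read the whole input. -/
abbrev ParserState : Type := Option (Tag × Phase)

/-- One transition of the parser: the new state and the symbols written, if the letter fits. -/
def read : ParserState → Letter → Option (ParserState × List Sym)
  | some (t, .start), .zero => some (some (t, .first), [.tag t false, .bit false])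
  | some (t, .start), .one => some (some (t, .first), [.tag t false, .bit true])
  | some (t, .start), .comma => some (some (t, t.afterFirst), .tag t false :: .comma :: t.pad)
  | some (t, .start), .close => some (t.next.map (·, .start), [])
  | some (t, .first), .zero => some (some (t, .first), [.bit false])
  | some (t, .first), .one => some (some (t, .first), [.bit true])
  | some (t, .first), .comma => some (some (t, t.afterFirst), .comma :: t.pad)
  | some (t, .second), .zero => some (some (t, .second), [.bit false])
  | some (t, .second), .one => some (some (t, .second), [.bit true])
  | some (t, .second), .comma => some (some (t, t.afterSecond), [.comma])
  | some (t, .finished), .close => some (some (t, .start), [])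
  | _, _ => none

/-- The output of the parser on an input, if it is accepted. -/
def transduce : ParserState → List Letter → Option (List Sym)
  | q, [] => if q.isNone then some [] else none
  | q, a :: w => (read q a).bind fun p => (transduce p.1 w).map (p.2 ++ ·)

section Transduce

variable {t : Tag} {w : List Letter} {out : List Sym}

theorem transduce_first (t : Tag) (φ : Sentence) (w : List Letter) :
    transduce (some (t, .first)) (encodeSentence φ ++ w) =
      (transduce (some (t, t.afterFirst)) w).map (word φ ++ t.pad ++ ·) := by
  induction φ with
  | nil => rfl
  | cons b φ ih =>
    have : transduce (some (t, .first)) (encodeSentence (b :: φ) ++ w) =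
        (transduce (some (t, .first)) (encodeSentence φ ++ w)).map (Sym.bit b :: ·) := by
      cases b <;> rfl
    rw [this, ih, Option.map_map]
    rfl

theorem transduce_second (t : Tag) (φ : Sentence) (w : List Letter) :
    transduce (some (t, .second)) (encodeSentence φ ++ w) =
      (transduce (some (t, t.afterSecond)) w).map (word φ ++ ·) := by
  induction φ with
  | nil => rfl
  | cons b φ ih =>
    have : transduce (some (t, .second)) (encodeSentence (b :: φ) ++ w) =
        (transduce (some (t, .second)) (encodeSentence φ ++ w)).map (Sym.bit b :: ·) := by
      cases b <;> rfl
    rw [this, ih, Option.map_map]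
    rfl

theorem transduce_start (t : Tag) (φ : Sentence) (w : List Letter) :
    transduce (some (t, .start)) (encodeSentence φ ++ w) =
      (transduce (some (t, t.afterFirst)) w).map fun s =>
        Sym.tag t false :: (word φ ++ t.pad ++ s) := by
  have : transduce (some (t, .start)) (encodeSentence φ ++ w) =
      (transduce (some (t, .first)) (encodeSentence φ ++ w)).map (Sym.tag t false :: ·) := by
    rcases φ with _ | ⟨b, φ⟩
    · simp [encodeSentence, transduce, read, Function.comp_def]
    · cases b <;> simp [encodeSentence, encodeBit, transduce, read, Function.comp_def]
  rw [this, transduce_first, Option.map_map]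
  rfl

theorem transduce_close (t : Tag) (w : List Letter) :
    transduce (some (t, .start)) (.close :: w) = transduce (t.next.map (·, .start)) w := by
  simp [transduce, read]

theorem transduce_stop (t : Tag) (w : List Letter) :
    transduce (some (t, .finished)) (.close :: w) = transduce (some (t, .start)) w := by
  simp [transduce, read]

/-- One of the inversions of the parser: acceptance forces the rest of the input to have the
expected shape. These show that nothing but codes is accepted. -/
theorem exists_sentence_of_first (h : transduce (some (t, .first)) w = some out) :
    ∃ φ w', w = encodeSentence φ ++ w' := by
  induction w generalizing out with
  | nil => simp [transduce] at h
  | cons a w ih =>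
    cases a with
    | zero =>
      simp only [transduce, read, Option.bind_some, Option.map_eq_some_iff] at h
      obtain ⟨out', h, -⟩ := h
      obtain ⟨φ, w', rfl⟩ := ih h
      exact ⟨false :: φ, w', rfl⟩
    | one =>
      simp only [transduce, read, Option.bind_some, Option.map_eq_some_iff] at h
      obtain ⟨out', h, -⟩ := h
      obtain ⟨φ, w', rfl⟩ := ih h
      exact ⟨true :: φ, w', rfl⟩
    | comma => exact ⟨[], w, rfl⟩
    | close => simp [transduce, read] at h

theorem exists_sentence_of_second (h : transduce (some (t, .second)) w = some out) :
    ∃ φ w', w = encodeSentence φ ++ w' := by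
  induction w generalizing out with
  | nil => simp [transduce] at h
  | cons a w ih =>
    cases a with
    | zero =>
      simp only [transduce, read, Option.bind_some, Option.map_eq_some_iff] at h
      obtain ⟨out', h, -⟩ := h
      obtain ⟨φ, w', rfl⟩ := ih h
      exact ⟨false :: φ, w', rfl⟩
    | one =>
      simp only [transduce, read, Option.bind_some, Option.map_eq_some_iff] at h
      obtain ⟨out', h, -⟩ := h
      obtain ⟨φ, w', rfl⟩ := ih h
      exact ⟨true :: φ, w', rfl⟩
    | comma => exact ⟨[], w, rfl⟩
    | close => simp [transduce, read] at h

theorem exists_sentence_of_start (h : transduce (some (t, .start)) w = some out) :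
    (∃ w', w = .close :: w') ∨ ∃ φ w', w = encodeSentence φ ++ w' := by
  rcases w with _ | ⟨a, w⟩
  · simp [transduce] at h
  · cases a with
    | zero =>
      simp only [transduce, read, Option.bind_some, Option.map_eq_some_iff] at h
      obtain ⟨out', h, -⟩ := h
      obtain ⟨φ, w', rfl⟩ := exists_sentence_of_first h
      exact Or.inr ⟨false :: φ, w', rfl⟩
    | one =>
      simp only [transduce, read, Option.bind_some, Option.map_eq_some_iff] at h
      obtain ⟨out', h, -⟩ := h
      obtain ⟨φ, w', rfl⟩ := exists_sentence_of_first h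
      exact Or.inr ⟨true :: φ, w', rfl⟩
    | comma => exact Or.inr ⟨[], w, rfl⟩
    | close => exact Or.inl ⟨w, rfl⟩

/-- The items of section `t` are of type `α`, coded by `e` and written as the records `f`. -/
structure IsSection (t : Tag) {α : Type} (e : α → List Letter) (f : α → Record) : Prop where
  transduce_item : ∀ a w, transduce (some (t, .start)) (e a ++ w) =
    (transduce (some (t, .start)) w).map ((f a).code ++ ·)
  exists_item : ∀ {w out}, transduce (some (t, .start)) w = some out →
    (∃ w', w = .close :: w') ∨ ∃ a w', w = e a ++ w'
  ne_nil : ∀ a, e a ≠ []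

namespace IsSection

variable {α : Type} {e : α → List Letter} {f : α → Record}

theorem transduce_list (h : IsSection t e f) (l : List α) (w : List Letter) :
    transduce (some (t, .start)) (encodeList e l ++ w) =
      (transduce (t.next.map (·, .start)) w).map (codes (l.map f) ++ ·) := by
  induction l with
  | nil => simp [encodeList, transduce_close, codes]
  | cons a l ih =>
    have : encodeList e (a :: l) ++ w = e a ++ (encodeList e l ++ w) := by simp [encodeList]
    rw [this, h.transduce_item, ih, Option.map_map]
    simp [codes, Function.comp_def]

theorem exists_list (h : IsSection t e f) (hw : transduce (some (t, .start)) w = some out) :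
    ∃ l w', w = encodeList e l ++ w' := by
  obtain ⟨n, hn⟩ : ∃ n, w.length = n := ⟨_, rfl⟩
  -- Each item consumes at least one letter, by `ne_nil`, but their number is not known in advance;
  -- hence induction on the length of the word.
  induction n using Nat.strong_induction_on generalizing w out with
  | _ n ih =>
    obtain ⟨w', rfl⟩ | ⟨a, w', rfl⟩ := h.exists_item hw
    · exact ⟨[], w', rfl⟩
    · rw [h.transduce_item, Option.map_eq_some_iff] at hw
      obtain ⟨out', hw, -⟩ := hw
      have := List.length_pos_of_ne_nil (h.ne_nil a)
      obtain ⟨l, w', rfl⟩ := ih w'.length (by rw [← hn, List.length_append]; omega) hw rfl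
      exact ⟨a :: l, w', by simp [encodeList]⟩

end IsSection

theorem encodeSentence_ne_nil (φ : Sentence) : encodeSentence φ ≠ [] := by simp [encodeSentence]

theorem isSection_lang : IsSection .lang encodeSentence fun φ => ⟨.lang, false, φ, []⟩ where
  transduce_item φ w := by
    rw [transduce_start]
    simp [Tag.afterFirst, Tag.pad, Record.code, Record.head, Record.fields, word]
  exists_item := exists_sentence_of_start
  ne_nil := encodeSentence_ne_nil

theorem isSection_cand : IsSection .cand encodeSentence fun φ => ⟨.cand, false, φ, []⟩ where
  transduce_item φ w := by
    rw [transduce_start]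
    simp [Tag.afterFirst, Tag.pad, Record.code, Record.head, Record.fields, word]
  exists_item := exists_sentence_of_start
  ne_nil := encodeSentence_ne_nil

theorem isSection_contr : IsSection .contr encodePair fun p => ⟨.contr, false, p.1, p.2⟩ where
  transduce_item p w := by
    rw [encodePair, List.append_assoc, transduce_start]
    simp only [Tag.afterFirst, transduce_second, Option.map_map]
    simp [Tag.afterSecond, Tag.pad, Record.code, Record.head, Record.fields, Function.comp_def]
  exists_item {w out} h := by
    obtain h' | ⟨φ, w', rfl⟩ := exists_sentence_of_start h
    · exact Or.inl h'
    · rw [transduce_start, Option.map_eq_some_iff] at h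
      obtain ⟨out', h, -⟩ := h
      obtain ⟨ψ, w', rfl⟩ := exists_sentence_of_second h
      exact Or.inr ⟨(φ, ψ), w', by simp [encodePair]⟩
  ne_nil p := by simp [encodePair, encodeSentence]

/-- A rule with a single premise. -/
def unaryRule (p : Sentence × Sentence) : Rule Sentence := ⟨p.1, [p.2]⟩

theorem encodeRule_unaryRule (p : Sentence × Sentence) :
    encodeRule (unaryRule p) = encodeSentence p.1 ++ (encodeSentence p.2 ++ [.close]) := by
  simp [encodeRule, unaryRule, encodeList]

/-- The phases `second` and `finished` demand one premise and then the end of the rule, so rules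
with no premise or several are rejected. This loses nothing, as bipolar frameworks have no such
rules. -/
theorem isSection_rule :
    IsSection .rule (fun p => encodeRule (unaryRule p)) fun p => ⟨.rule, false, p.1, p.2⟩ where
  transduce_item p w := by
    rw [encodeRule_unaryRule, List.append_assoc, List.append_assoc, transduce_start]
    simp only [Tag.afterFirst, transduce_second, Option.map_map, Tag.afterSecond,
      List.singleton_append, transduce_stop]
    simp [Tag.pad, Record.code, Record.head, Record.fields, Function.comp_def]
  exists_item {w out} h := by
    obtain h' | ⟨φ, w', rfl⟩ := exists_sentence_of_start h
    · exact Or.inl h'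
    · rw [transduce_start, Option.map_eq_some_iff] at h
      obtain ⟨out', h, -⟩ := h
      obtain ⟨ψ, w', rfl⟩ := exists_sentence_of_second h
      rw [Tag.afterFirst, transduce_second, Option.map_eq_some_iff] at h
      obtain ⟨out'', h, -⟩ := h
      obtain ⟨w'', rfl⟩ : ∃ w'', w' = .close :: w'' := by
        rcases w' with _ | ⟨a, w'⟩
        · simp [transduce] at h
        · cases a <;> first | exact ⟨_, rfl⟩ | simp [transduce, read, Tag.afterSecond] at h
      exact Or.inr ⟨(φ, ψ), w'', by simp [encodeRule_unaryRule]⟩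
  ne_nil p := by simp [encodeRule_unaryRule, encodeSentence]

/-- The data of a listing all of whose rules have one premise. -/
structure UnaryListing where
  lang : List Sentence
  rules : List (Sentence × Sentence)
  contraries : List (Sentence × Sentence)
  candidate : List Sentence

namespace UnaryListing

def toListing (D : UnaryListing) : Listing := ⟨D.lang, D.rules.map unaryRule, D.contraries, D.candidate⟩

def records (D : UnaryListing) : List Record :=
  D.lang.map (fun φ => ⟨.lang, false, φ, []⟩) ++
    (D.rules.map (fun p => ⟨.rule, false, p.1, p.2⟩) ++
      (D.contraries.map (fun p => ⟨.contr, false, p.1, p.2⟩) ++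
        D.candidate.map fun φ => ⟨.cand, false, φ, []⟩))

theorem encode_toListing (D : UnaryListing) :
    D.toListing.encode = encodeList encodeSentence D.lang ++
      (encodeList (fun p => encodeRule (unaryRule p)) D.rules ++
        (encodeList encodePair D.contraries ++ (encodeList encodeSentence D.candidate ++ []))) := by
  simp [Listing.encode, toListing, encodeList, List.flatMap_map]

theorem transduce_encode (D : UnaryListing) :
    transduce (some (.lang, .start)) D.toListing.encode = some (codes D.records) := by
  rw [encode_toListing, isSection_lang.transduce_list]
  simp only [Tag.next, Option.map_some]
  rw [isSection_rule.transduce_list]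
  simp only [Tag.next, Option.map_some]
  rw [isSection_contr.transduce_list]
  simp only [Tag.next, Option.map_some]
  rw [isSection_cand.transduce_list]
  simp [Tag.next, transduce, records, codes]

/-- With `transduce_encode` this identifies the accepted words as the codes of unary listings. The
four sections are peeled off in order, each acceptance yielding acceptance of the remainder. -/
theorem exists_of_transduce (h : transduce (some (.lang, .start)) w = some out) :
    ∃ D : UnaryListing, w = D.toListing.encode := by
  obtain ⟨l₁, w, rfl⟩ := isSection_lang.exists_list h
  rw [isSection_lang.transduce_list, Option.map_eq_some_iff] at h
  obtain ⟨_, h, -⟩ := h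
  change transduce (some (.rule, .start)) _ = _ at h
  obtain ⟨l₂, w, rfl⟩ := isSection_rule.exists_list h
  rw [isSection_rule.transduce_list, Option.map_eq_some_iff] at h
  obtain ⟨_, h, -⟩ := h
  change transduce (some (.contr, .start)) _ = _ at h
  obtain ⟨l₃, w, rfl⟩ := isSection_contr.exists_list h
  rw [isSection_contr.transduce_list, Option.map_eq_some_iff] at h
  obtain ⟨_, h, -⟩ := h
  change transduce (some (.cand, .start)) _ = _ at h
  obtain ⟨l₄, w, rfl⟩ := isSection_cand.exists_list h
  rw [isSection_cand.transduce_list, Option.map_eq_some_iff] at h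
  obtain ⟨_, h, -⟩ := h
  -- Behind the last section the parser is in the state `none`, where it can read no letter.
  obtain rfl : w = [] := by
    rcases w with _ | ⟨a, w⟩
    · rfl
    · cases a <;> simp [transduce, read, Tag.next] at h
  exact ⟨⟨l₁, l₂, l₃, l₄⟩, by rw [encode_toListing]⟩

end UnaryListing

/-- The worst case is an empty sentence in a padded section: tag, comma and the comma of the empty
second field. -/
theorem length_read {q q' : ParserState} {a : Letter} {out : List Sym}
    (h : read q a = some (q', out)) : out.length ≤ 3 := by
  have hp : ∀ t : Tag, t.pad.length ≤ 1 := by intro t; cases t <;> simp [Tag.pad]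
  rcases q with _ | ⟨t, _ | _ | _ | _⟩ <;> cases a <;> simp [read] at h <;>
    obtain ⟨-, rfl⟩ := h <;> simp <;> have := hp t <;> omega

theorem length_transduce {q : ParserState} (h : transduce q w = some out) :
    out.length ≤ 3 * w.length := by
  induction w generalizing q out with
  | nil =>
    simp only [transduce] at h
    split_ifs at h
    obtain rfl : [] = out := Option.some.inj h
    simp
  | cons a w ih =>
    simp only [transduce, Option.bind_eq_some_iff, Option.map_eq_some_iff] at h
    obtain ⟨⟨q', o⟩, h₁, out', h₂, rfl⟩ := h
    have := length_read h₁
    have := ih h₂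
    simp only [List.length_append, List.length_cons]
    omega

end Transduce

/-! ### The parser as a program -/

/-- Read a letter of the input. -/
def popInput : Prog (Option Letter) :=
  Frag.pop (Γ := Alphabet) .inp (fun _ a => (none, a, false)) fun v => v.2.1

theorem update_layout_inp (w w' o n T) :
    Function.update (layout w o n T) .inp w' = layout w' o n T := by
  funext k
  by_cases hk : k = .inp
  · subst hk
    simp [layout]
  · rw [Function.update_of_ne hk]
    rcases k with _ | _ | _ | ⟨d, i⟩
    · exact absurd rfl hk
    · rfl
    · rfl
    · cases d <;> rfl

theorem update_layout_cnt (w o n n' T) :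
    Function.update (layout w o n T) .cnt (List.replicate n' ()) = layout w o n' T := by
  funext k
  by_cases hk : k = .cnt
  · subst hk
    simp [layout]
  · rw [Function.update_of_ne hk]
    rcases k with _ | _ | _ | ⟨d, i⟩
    · rfl
    · rfl
    · exact absurd rfl hk
    · cases d <;> rfl

theorem runs_popInput (w o n T) :
    popInput.Runs (layout w o n T) w.head? (layout w.tail o n T) 1 := by
  have h := Frag.runs_pop (Γ := Alphabet) (σ := Reg) .inp (fun _ a => (none, a, false))
    (fun v => v.2.1) (layout w o n T) w.head? (fun v => rfl)
  rw [show (layout w o n T .inp).tail = w.tail from rfl, update_layout_inp] at h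
  exact h

/-- Increment the counter. -/
def pushCounter : Prog Unit := Frag.push (Γ := Alphabet) .cnt ()

theorem runs_pushCounter (w o n T) :
    pushCounter.Runs (layout w o n T) () (layout w o (n + 1) T) 1 := by
  have h := Frag.runs_push (Γ := Alphabet) (σ := Reg) .cnt () (layout w o n T)
  rw [show (() :: layout w o n T .cnt) = List.replicate (n + 1) () from rfl,
    update_layout_cnt] at h
  exact h

/-- Write symbols before the head of the first tape. -/
def write : List Sym → Prog Unit
  | [] => Frag.pure ()
  | a :: s => (pushTape false 0 a).bind fun _ => write s

theorem runs_write (s l : List Sym) :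
    TapeRuns (write s) (spread l []) () (spread (s.reverse ++ l) []) (s.length + 1) := by
  induction s generalizing l with
  | nil => exact TapeRuns.pure ()
  | cons a s ih =>
    have h := runs_pushTape (d := false) (i := 0) (T := spread l []) a (s := l) (t := []) rfl
    have hT : Function.update (spread l []) 0 (zip false (a :: l) []) = spread (a :: l) [] := by
      funext i
      by_cases hi : i = 0
      · subst hi
        simp [spread, zip]
      · simp [spread, hi]
    rw [hT] at h
    have h' := ih (a :: l)
    rw [List.reverse_cons, List.append_assoc]
    have h'' : TapeRuns (write (a :: s)) _ _ _ _ := TapeRuns.bind h h'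
    exact h''.mono (by simp; omega)

/-- One transition of the parser. -/
def parseStep (q : ParserState) : Prog (ParserState ⊕ Bool) :=
  popInput.bind fun
    | none => Frag.pure (Sum.inr q.isNone)
    | some a =>
      match read q a with
      | none => Frag.pure (Sum.inr false)
      | some (q', s) => pushCounter.bind fun _ => (write s).map fun _ => Sum.inl q'

/-- Parse the input, writing the records before the head of the first tape. -/
def parse (q : ParserState) : Prog Bool := Frag.iter parseStep q

theorem runs_parseStep_nil (q : ParserState) (o n T) :
    (parseStep q).Runs (layout [] o n T) (Sum.inr q.isNone) (layout [] o n T) 2 := by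
  refine Frag.Runs.bind (runs_popInput [] o n T) (t₂ := 1) ?_
  exact Frag.runs_pure _ _

theorem runs_parseStep_none {q : ParserState} {a : Letter} (h : read q a = none) (w o n T) :
    (parseStep q).Runs (layout (a :: w) o n T) (Sum.inr false) (layout w o n T) 2 := by
  refine Frag.Runs.bind (runs_popInput (a :: w) o n T) (t₂ := 1) ?_
  simp only [List.head?_cons, h]
  exact Frag.runs_pure _ _

theorem runs_parseStep_some {q q' : ParserState} {a : Letter} {s : List Sym}
    (h : read q a = some (q', s)) (w o n l) :
    (parseStep q).Runs (layout (a :: w) o n (spread l [])) (Sum.inl q')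
      (layout w o (n + 1) (spread (s.reverse ++ l) [])) 6 := by
  have h' : (parseStep q).Runs (layout (a :: w) o n (spread l [])) (Sum.inl q')
      (layout w o (n + 1) (spread (s.reverse ++ l) [])) (1 + (1 + (s.length + 1))) := by
    refine Frag.Runs.bind (runs_popInput (a :: w) o n _) ?_
    simp only [List.head?_cons, h]
    exact Frag.Runs.bind (runs_pushCounter _ _ _ _)
      ((runs_write s l w o (n + 1)).map fun _ => Sum.inl q')
  -- At most three symbols are written, so the sum is at most `1 + 1 + (3 + 1)`.
  exact h'.mono (by have := length_read h; omega)

/-- The counter grows by one with each letter; this is how the later marking obtains its number of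
rounds. -/
theorem runs_parse_some {q : ParserState} {w : List Letter} {out : List Sym}
    (h : transduce q w = some out) (o n l) :
    (parse q).Runs (layout w o n (spread l [])) true
      (layout [] o (n + w.length) (spread (out.reverse ++ l) [])) (6 * w.length + 2) := by
  induction w generalizing q n l out with
  | nil =>
    simp only [transduce] at h
    split_ifs at h with hq
    obtain rfl : [] = out := Option.some.inj h
    have := runs_parseStep_nil q o n (spread l [])
    rw [hq] at this
    exact this.iter_exit
  | cons a w ih =>
    simp only [transduce, Option.bind_eq_some_iff, Option.map_eq_some_iff] at h
    obtain ⟨⟨q', s⟩, h₁, out', h₂, rfl⟩ := h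
    have h₃ : (parse q).Runs _ _ _ _ :=
      Frag.Runs.iter_again (runs_parseStep_some h₁ w o n l) (ih h₂ (n + 1) (s.reverse ++ l))
    have e : n + (a :: w).length = n + 1 + w.length := by simp; omega
    rw [e, List.reverse_append, List.append_assoc]
    exact h₃.mono (by simp; omega)

/-- What a failed parse leaves behind is irrelevant except for its size, which bounds the time of
the cleanup. -/
theorem runs_parse_none {q : ParserState} {w : List Letter} (h : transduce q w = none) (o n l) :
    ∃ w' n' l', w'.length ≤ w.length ∧ n' ≤ n + w.length ∧ l'.length ≤ l.length + 3 * w.length ∧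
      (parse q).Runs (layout w o n (spread l [])) false (layout w' o n' (spread l' []))
        (6 * w.length + 2) := by
  induction w generalizing q n l with
  | nil =>
    refine ⟨[], n, l, by simp, by simp, by simp, ?_⟩
    have := runs_parseStep_nil q o n (spread l [])
    simp only [transduce] at h
    split_ifs at h with hq
    rw [Bool.not_eq_true] at hq
    rw [hq] at this
    exact this.iter_exit
  | cons a w ih =>
    rcases h₁ : read q a with _ | ⟨q', s⟩
    · refine ⟨w, n, l, by simp, by omega, by omega, ?_⟩
      exact (runs_parseStep_none h₁ w o n (spread l [])).iter_exit.mono (by omega)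
    · have h₂ : transduce q' w = none := by simpa [transduce, h₁] using h
      obtain ⟨w', n', l', hw, hn, hl, hr⟩ := ih h₂ (n + 1) (s.reverse ++ l)
      have h₃ : (parse q).Runs _ _ _ _ :=
        Frag.Runs.iter_again (runs_parseStep_some h₁ w o n l) hr
      have := length_read h₁
      simp only [List.length_append, List.length_reverse] at hl
      refine ⟨w', n', l', ?_, ?_, ?_, h₃.mono ?_⟩ <;> simp only [List.length_cons] <;> omega

end ABA


namespace ABA

/-! ### The verifier -/

/-- Empty some stacks. -/
def eraseAll : List Stack → Prog Unit
  | [] => Frag.pure ()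
  | k :: ks => (erase k).bind fun _ => eraseAll ks

theorem runs_eraseAll (ks : List Stack) (S : ∀ k, List (Alphabet k)) {M : ℕ}
    (h : ∀ k, (S k).length ≤ M) :
    (eraseAll ks).Runs S () (fun k => if k ∈ ks then [] else S k) (ks.length * (M + 1) + 1) := by
  induction ks generalizing S with
  | nil =>
    have hS : (fun j => if j ∈ ([] : List Stack) then [] else S j) = S := by simp
    rw [hS]
    exact (Frag.runs_pure () S).mono (by simp)
  | cons k ks ih =>
    have h₁ := ih (Function.update S k []) (fun j => by
      by_cases hj : j = k
      · subst hj
        simp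
      · rw [Function.update_of_ne hj]
        exact h j)
    have hS : (fun j => if j ∈ k :: ks then [] else S j) =
        fun j => if j ∈ ks then [] else Function.update S k [] j := by
      funext j
      by_cases hj : j = k
      · subst hj
        simp
      · simp [hj]
    rw [hS]
    have h₂ : (eraseAll (k :: ks)).Runs _ _ _ _ := Frag.Runs.bind (runs_erase k S) h₁
    refine h₂.mono ?_
    rw [List.length_cons, Nat.add_mul]
    have := h k
    omega

/-- Empty all stacks except for the output. -/
def cleanup : Prog Unit :=
  eraseAll [.inp, .cnt, .tape false 0, .tape false 1, .tape false 2, .tape false 3,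
    .tape true 0, .tape true 1, .tape true 2, .tape true 3]

/-- A halting configuration in the sense of `haltList` has all stacks but the output empty. There
are ten such stacks, each of height at most `M`. -/
theorem runs_cleanup {w : List Letter} {n : ℕ} {l s : List Sym} {M : ℕ} (hw : w.length ≤ M)
    (hn : n ≤ M) (hl : l.length ≤ M) (hs : s.length ≤ M) :
    cleanup.Runs (layout w [] n (spread l s)) () (layout [] [] 0 (spread [] []))
      (10 * (M + 1) + 1) := by
  have h := runs_eraseAll [.inp, .cnt, .tape false 0, .tape false 1, .tape false 2, .tape false 3,
    .tape true 0, .tape true 1, .tape true 2, .tape true 3] (layout w [] n (spread l s)) (M := M)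
    (fun k => by
      rcases k with _ | _ | _ | ⟨_ | _, i⟩
      · exact hw
      · exact Nat.zero_le _
      · simpa [layout] using hn
      · by_cases hi : i = 0 <;> simp [layout, spread, hi, hl]
      · exact hs)
  suffices hS : layout [] [] 0 (spread [] []) = fun k => if k ∈ [Stack.inp, .cnt, .tape false 0,
      .tape false 1, .tape false 2, .tape false 3, .tape true 0, .tape true 1, .tape true 2,
      .tape true 3] then [] else layout w [] n (spread l s) k by
    rw [hS]
    exact h
  funext k
  rcases k with _ | _ | _ | ⟨_ | _, i⟩
  · simp [layout]
  · simp [layout]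
  · simp [layout]
  · fin_cases i <;> simp [layout, spread]
  · fin_cases i <;> simp [layout, spread]

theorem UnaryListing.toListing_injective : Function.Injective UnaryListing.toListing := by
  intro D E h
  have hr : Function.Injective unaryRule := fun p q hpq => by
    simp only [unaryRule, Rule.mk.injEq, List.cons.injEq, and_true] at hpq
    exact Prod.ext hpq.1 hpq.2
  cases D
  cases E
  simpa [toListing, hr.list_map.eq_iff] using h

/-- Parse the input, mark records as long as the counter says, and test the result. -/
def decideProg (F G : Prog Bool) : Prog Bool :=
  (parse (some (.lang, .start))).bind fun ok =>
    if ok then distribute.bind fun _ => (repeatProg (round F)).bind fun _ => G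
    else Frag.pure false

/-- Write the answer on the output stack, and empty the other stacks. -/
def answer (F : Prog Bool) : Prog Unit :=
  F.bind fun b => cleanup.bind fun _ => Frag.push (Γ := Alphabet) .out b

variable {P Q : List Record → (Fin 4 → Record) → Prop}

/-- The time that the verifier takes. -/
noncomputable def verifierTime (p q : Polynomial ℕ) : Polynomial ℕ :=
  (6 * .X + 2) + ((5 * (3 * .X) + 2) + ((.X + 1) * ((3 * .X + 1) *
    (p.comp (3 * .X) + 2 * (3 * .X) + 5) + (8 * (3 * .X) + 5) + 2) + q.comp (3 * .X))) +
    ((10 * (3 * .X + 1) + 1) + 2)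

/-- All tape contents have length at most three times that of the input, which explains the
substitutions of `3 * X` in `verifierTime`. The valuation `v` is arbitrary because the final test
has no free variables. -/
theorem runs_answer (F : Test 1 P) (G : Test 0 Q) (v : Fin 4 → Record) (w : List Letter) :
    ∃ b, (b = true ↔ ∃ D : UnaryListing, w = D.toListing.encode ∧
        Q ((markAll P)^[w.length] D.records) v) ∧
      (answer (decideProg F.prog G.prog)).Runs (layout w [] 0 (spread [] [])) ()
        (layout [] [b] 0 (spread [] [])) ((verifierTime F.time G.time).eval w.length) := by
  -- Writing the answer and cleaning up, for accepted and rejected parses alike.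
  have out : ∀ {w' n l s b t}, w'.length ≤ 3 * w.length → n ≤ 3 * w.length →
      l.length ≤ 3 * w.length → s.length ≤ 3 * w.length →
      (decideProg F.prog G.prog).Runs (layout w [] 0 (spread [] [])) b
        (layout w' [] n (spread l s)) t →
      (answer (decideProg F.prog G.prog)).Runs (layout w [] 0 (spread [] [])) ()
        (layout [] [b] 0 (spread [] [])) (t + ((10 * (3 * w.length + 1) + 1) + 1)) := by
    intro w' n l s b t hw hn hl hs h
    have h₁ := runs_cleanup hw hn hl hs
    have h₂ := Frag.runs_push (Γ := Alphabet) (σ := Reg) .out b (layout [] [] 0 (spread [] []))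
    have hS : Function.update (layout [] [] 0 (spread [] [])) .out
        (b :: layout [] [] 0 (spread [] []) .out) = layout [] [b] 0 (spread [] []) := by
      funext k
      by_cases hk : k = .out
      · subst hk
        simp [layout]
      · rw [Function.update_of_ne hk]
        rcases k with _ | _ | _ | ⟨d, i⟩
        · rfl
        · exact absurd rfl hk
        · rfl
        · cases d <;> rfl
    rw [hS] at h₂
    exact Frag.Runs.bind h (Frag.Runs.bind h₁ h₂)
  simp only [verifierTime, Polynomial.eval_add, Polynomial.eval_mul, Polynomial.eval_comp,
    Polynomial.eval_X, Polynomial.eval_ofNat, Polynomial.eval_one]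
  rcases h : transduce (some (.lang, .start)) w with _ | s
  · obtain ⟨w', n, l, hw, hn, hl, hr⟩ := runs_parse_none h [] 0 []
    have hr' : (decideProg F.prog G.prog).Runs _ _ _ _ :=
      Frag.Runs.bind hr (Frag.runs_pure false _)
    refine ⟨false, ?_, (out (by omega) (by omega) (by simpa using hl) (by simp) hr').mono
      (by omega)⟩
    simp only [Bool.false_eq_true, false_iff, not_exists, not_and]
    rintro D rfl
    rw [D.transduce_encode] at h
    exact absurd h (by simp)
  · obtain ⟨D, hD⟩ := UnaryListing.exists_of_transduce h
    have hs : s = codes D.records := by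
      rw [hD, D.transduce_encode] at h
      exact (Option.some.inj h).symm
    subst hs
    have hlen := length_transduce h
    have h₁ := runs_parse_some h [] 0 []
    rw [Nat.zero_add, List.append_nil] at h₁
    have h₂ := runs_distribute (codes D.records).reverse [] [] [] w.length
    rw [List.reverse_reverse, List.append_nil, List.length_reverse] at h₂
    have h₃ := runs_repeatProg F [] [] (n := w.length) hlen
    set db := (markAll P)^[w.length] D.records with hdb
    have hlen' : (codes db).length ≤ 3 * w.length := by
      have : ∀ n, (codes ((markAll P)^[n] D.records)).length = (codes D.records).length := by
        intro n
        induction n with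
        | zero => rfl
        | succ n ih => rw [Function.iterate_succ_apply', length_codes_markAll, ih]
      rw [hdb, this]
      exact hlen
    obtain ⟨b, hb, hG⟩ := G.spec (db := db) (v := v) (T := spread [] (codes db))
      ⟨fun i hi => absurd hi (by omega), fun i _ => by simp [spread]⟩ hlen'
      (fun i hi => absurd hi (by omega))
    have hr : (decideProg F.prog G.prog).Runs _ _ _ _ :=
      Frag.Runs.bind h₁ (Frag.Runs.bind h₂ (Frag.Runs.bind h₃ (hG [] [] 0)))
    refine ⟨b, hb.trans ⟨fun hQ => ⟨D, hD, hQ⟩, ?_⟩, (out (by simp) (by simp) (by simp) hlen' hr).mono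
      (by omega)⟩
    -- The code is injective, so the listing found by the parser is the only one that the word can
    -- encode.
    rintro ⟨D', hD', hQ⟩
    obtain rfl := UnaryListing.toListing_injective (Listing.encode_injective (hD.symm.trans hD'))
    exact hQ

theorem initList_toFinTM2 (F : Prog Unit) [Fintype (Alphabet .inp)] (v₀ : Reg) (w : List Letter) :
    Turing.initList (F.toFinTM2 .inp .out v₀) w =
      ⟨some (Sum.inl F.entry), v₀, layout w [] 0 (spread [] [])⟩ := by
  unfold Turing.initList
  congr 1
  funext k
  rcases k with _ | _ | _ | ⟨_ | _, i⟩
  · rfl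
  · rfl
  · rfl
  · exact (ite_self _).symm
  · rfl

theorem haltList_toFinTM2 (F : Prog Unit) [Fintype (Alphabet .inp)] (v₀ : Reg) (o : List Bool) :
    Turing.haltList (F.toFinTM2 .inp .out v₀) o =
      ⟨none, v₀, layout [] o 0 (spread [] [])⟩ := by
  unfold Turing.haltList
  congr 1
  funext k
  rcases k with _ | _ | _ | ⟨_ | _, i⟩
  · rfl
  · rfl
  · rfl
  · exact (ite_self _).symm
  · rfl

/-- A language that is decided by the verifier is in P. -/
theorem inP_of_tests (F : Test 1 P) (G : Test 0 Q) (v : Fin 4 → Record) {L : Language Letter}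
    (hL : ∀ w, w ∈ L ↔ ∃ D : UnaryListing, w = D.toListing.encode ∧
        Q ((markAll P)^[w.length] D.records) v) : InP L := by
  classical
  -- The function is the classical characteristic function of `L`; its computability is supplied by
  -- the machine below.
  refine ⟨fun w => decide (w ∈ L), fun w => decide_eq_true_iff, ⟨?_⟩⟩
  letI : Fintype (Alphabet .inp) := inferInstanceAs (Fintype Letter)
  refine
    { tm := (answer (decideProg F.prog G.prog)).toFinTM2 .inp .out (none, none, false)
      inputAlphabet := Equiv.refl Letter
      outputAlphabet := Equiv.refl Bool
      time := verifierTime F.time G.time + 1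
      outputsFun := fun w => Classical.choice ?_ }
  obtain ⟨b, hb, hr⟩ := runs_answer F G v w
  obtain rfl : b = decide (w ∈ L) := by
    rw [Bool.eq_iff_iff, hb, decide_eq_true_iff, hL]
  have h := hr.evalsTo (k₀ := .inp) (k₁ := .out) (v₀ := (none, none, false))
  rw [← initList_toFinTM2, ← haltList_toFinTM2] at h
  rw [Polynomial.eval_add, Polynomial.eval_one]
  -- The machine is given the image of `w` under the identity equivalence, which equals `w` only
  -- propositionally; hence the free word `w'`.
  have key : ∀ w', w' = w → Nonempty (Turing.TM2OutputsInTime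
      ((answer (decideProg F.prog G.prog)).toFinTM2 .inp .out (none, none, false)) w'
      (some [decide (w ∈ L)]) ((verifierTime F.time G.time).eval w.length + 1)) := by
    rintro _ rfl
    exact h
  exact key _ (List.map_id w)

end ABA


namespace ABA

/-! ### Bipolar frameworks -/

namespace Framework

variable {S : Type*} (F : Framework S)

/-- There is a rule from `a` to `b`. -/
def Edge (a b : S) : Prop := (⟨b, [a]⟩ : Rule S) ∈ F.rules

/-- `φ` is deducible from a subset of `A`. -/
def Derivable (A : Set S) (φ : S) : Prop := ∃ A' ⊆ A, ∃ R ⊆ F.rules, F.Deduction A' R φ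

/-- `φ` is in `A` or the head of a rule from `A`. -/
def Near (A : Set S) (φ : S) : Prop := φ ∈ A ∨ ∃ a ∈ A, F.Edge a φ

/-- The set `A` is one rule away from the contrary of an assumption that `b` leads to. -/
def Doomed (A : Set S) (b : S) : Prop :=
  ∃ β : F.assumptions, Relation.ReflTransGen F.Edge b β ∧ F.Near A (F.contrary β)

variable {F} {A : Set S}

theorem Bipolar.mem_of_edge (hF : F.Bipolar) {a b : S} (h : F.Edge a b) : a ∈ F.assumptions := by
  obtain ⟨α, hα, h, -⟩ := hF _ h
  obtain rfl : a = α := by simpa using h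
  exact hα

/-- With one premise per rule a deduction tree does not branch: it is a path from its only leaf to
its root. -/
theorem Bipolar.derivable_iff (hF : F.Bipolar) {φ : S} :
    F.Derivable A φ ↔ ∃ α ∈ A, α ∈ F.assumptions ∧ Relation.ReflTransGen F.Edge α φ := by
  constructor
  · rintro ⟨A', hA, R, -, h⟩
    suffices ∃ α ∈ A', α ∈ F.assumptions ∧ Relation.ReflTransGen F.Edge α φ by
      obtain ⟨α, h₁, h₂⟩ := this
      exact ⟨α, hA h₁, h₂⟩
    clear hA
    induction h with
    | leaf α hα => exact ⟨α, rfl, hα, .refl⟩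
    | node r hr B R h ih =>
      rcases r with ⟨φ, body⟩
      obtain ⟨β, hβ, hb, -⟩ := hF _ hr
      change body = [β] at hb
      subst hb
      -- The body is a singleton, so the node has a single child.
      obtain ⟨α, h₁, h₂, h₃⟩ := ih 0
      exact ⟨α, Set.mem_iUnion_of_mem _ h₁, h₂, h₃.tail hr⟩
  · rintro ⟨α, hα, hα', h⟩
    suffices ∃ R ⊆ F.rules, F.Deduction {α} R φ from
      ⟨{α}, Set.singleton_subset_iff.2 hα, this⟩
    induction h with
    | refl => exact ⟨∅, Set.empty_subset _, .leaf α hα'⟩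
    | @tail b c _ hbc ih =>
      obtain ⟨R, hR, h⟩ := ih
      have := Deduction.node (F := F) ⟨c, [b]⟩ hbc (fun _ => {α}) (fun _ => R) (fun i => by
        obtain rfl : i = (0 : Fin 1) := Subsingleton.elim (α := Fin 1) _ _
        exact h)
      rw [show (⋃ _ : Fin (Rule.body ⟨c, [b]⟩).length, ({α} : Set S)) = {α} from
          Set.iUnion_const (ι := Fin 1) _,
        show (⋃ _ : Fin (Rule.body ⟨c, [b]⟩).length, R) = R from
          Set.iUnion_const (ι := Fin 1) _] at this
      exact ⟨_, Set.insert_subset hbc hR, this⟩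

/-- A path out of `A` that ends in an assumption has only assumptions as vertices, since each
earlier vertex is a premise. One-step closure therefore carries along the whole path. -/
theorem Bipolar.closed_iff (hF : F.Bipolar) (hA : A ⊆ F.assumptions) :
    F.Closed A ↔ ∀ a ∈ A, ∀ b ∈ F.assumptions, F.Edge a b → b ∈ A := by
  constructor
  · intro h a ha b hb hab
    rw [h]
    exact ⟨hb, hF.derivable_iff.2 ⟨a, ha, hA ha, .single hab⟩⟩
  · intro h
    refine Set.Subset.antisymm (fun α hα => ⟨hA hα, hF.derivable_iff.2 ⟨α, hα, hA hα, .refl⟩⟩) ?_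
    rintro φ ⟨hφ, hd⟩
    obtain ⟨α, hα, -, hr⟩ := hF.derivable_iff.1 hd
    induction hr with
    | refl => exact hα
    | tail _ hbc ih =>
      have hb := hF.mem_of_edge hbc
      exact h _ (ih hb (hF.derivable_iff.2 ⟨α, hα, hA hα, by assumption⟩)) _ hφ hbc

theorem Closed.subset (h : F.Closed A) : A ⊆ F.assumptions := by
  rw [h]
  exact fun φ hφ => hφ.1

/-- The last edge of a path starts at an assumption derivable from `A`, hence in `A` by closedness.
So attacks by `A` can be read off without any search for paths. -/
theorem Bipolar.derivable_iff_near (hF : F.Bipolar) (h : F.Closed A) {φ : S} :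
    F.Derivable A φ ↔ F.Near A φ := by
  have hA := h.subset
  rw [hF.derivable_iff]
  constructor
  · rintro ⟨α, hα, hα', hr⟩
    rcases hr.cases_tail with rfl | ⟨c, hr, hc⟩
    · exact Or.inl hα
    · refine Or.inr ⟨c, ?_, hc⟩
      rw [h]
      exact ⟨hF.mem_of_edge hc, hF.derivable_iff.2 ⟨α, hα, hα', hr⟩⟩
  · rintro (hφ | ⟨a, ha, hr⟩)
    · exact ⟨φ, hφ, hA hφ, .refl⟩
    · exact ⟨a, ha, hA ha, .single hr⟩

theorem Bipolar.attacks_iff (hF : F.Bipolar) (h : F.Closed A) {B : Set S} :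
    F.Attacks A B ↔ ∃ β : F.assumptions, (β : S) ∈ B ∧ F.Near A (F.contrary β) :=
  exists_congr fun _ => and_congr_right fun _ => hF.derivable_iff_near h

/-- For an assumption `b` this is the least closed set containing it, the weakest opponent that `A`
must be able to attack. -/
theorem Bipolar.closed_reachable (hF : F.Bipolar) (b : S) :
    F.Closed {φ | φ ∈ F.assumptions ∧ Relation.ReflTransGen F.Edge b φ} :=
  (hF.closed_iff fun _ h => h.1).2 fun _ ha _ hb hab => ⟨hb, ha.2.tail hab⟩

/-- The quantifier over closed attackers disappears. For necessity, test against the set reachable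
from an attacking `b`; for sufficiency, a closed attacker contains everything its attacking element
reaches, in particular the target that makes this element doomed. -/
theorem Bipolar.defends_iff (hF : F.Bipolar) (h : F.Closed A) (α : F.assumptions) :
    F.Defends A α ↔
      ((F.contrary α : S) ∈ F.assumptions → F.Doomed A (F.contrary α)) ∧
        ∀ c, F.Edge c (F.contrary α) → F.Doomed A c := by
  constructor
  · intro hd
    have key : ∀ b ∈ F.assumptions, Relation.ReflTransGen F.Edge b (F.contrary α) →
        F.Doomed A b := by
      intro b hb hr
      have hc := hF.closed_reachable b
      obtain ⟨β, hβ, hn⟩ := (hF.attacks_iff h).1 (hd _ hc.subset hc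
        ⟨α, rfl, hF.derivable_iff.2 ⟨b, ⟨hb, .refl⟩, hb, hr⟩⟩)
      exact ⟨β, hβ.2, hn⟩
    exact ⟨fun hα => key _ hα .refl, fun c hc => key c (hF.mem_of_edge hc) (.single hc)⟩
  · rintro ⟨h₁, h₂⟩ B - hB ⟨β, hβ, hatt⟩
    obtain rfl : β = α := Subtype.ext hβ
    obtain ⟨b, hb, hb', hr⟩ := hF.derivable_iff.1 hatt
    -- Either `b` is the contrary itself, or its path enters the contrary from some doomed `c`, and
    -- doom is inherited backwards along the path from `b` to `c`.
    have hdoom : F.Doomed A b := by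
      rcases hr.cases_tail with hbc | ⟨c, hr, hc⟩
      · rw [← hbc]
        exact h₁ (hbc ▸ hb')
      · obtain ⟨γ, hγ, hn⟩ := h₂ c hc
        exact ⟨γ, hr.trans hγ, hn⟩
    obtain ⟨γ, hγ, hn⟩ := hdoom
    refine (hF.attacks_iff h).2 ⟨γ, ?_, hn⟩
    rw [hB]
    exact ⟨γ.2, hF.derivable_iff.2 ⟨b, hb, hb', hγ⟩⟩

theorem Bipolar.admissible_iff (hF : F.Bipolar) :
    F.Admissible A ↔ A ⊆ F.assumptions ∧
      (∀ a ∈ A, ∀ b ∈ F.assumptions, F.Edge a b → b ∈ A) ∧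
      (∀ α : F.assumptions, (α : S) ∈ A → ¬ F.Near A (F.contrary α)) ∧
      ∀ α : F.assumptions, (α : S) ∈ A →
        ((F.contrary α : S) ∈ F.assumptions → F.Doomed A (F.contrary α)) ∧
          ∀ c, F.Edge c (F.contrary α) → F.Doomed A c := by
  refine and_congr_right fun hA => ?_
  rw [← hF.closed_iff hA]
  refine and_congr_right fun h => and_congr ?_ ?_
  · rw [ConflictFree, hF.attacks_iff h]
    push Not
    rfl
  · exact ⟨fun hd α hα => (hF.defends_iff h α).1 (hd α hα),
      fun hd α hα => (hF.defends_iff h ⟨α, hA hα⟩).2 (hd _ hα)⟩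

end Framework

end ABA


namespace ABA

/-! ### The tests -/

/-- The sentence is in the candidate or the head of a rule whose premise is. -/
def NearIn (db : List Record) (φ : Sentence) : Prop :=
  (∃ a ∈ db, a.tag = .cand ∧ a.fst = φ) ∨
    ∃ r ∈ db, r.tag = .rule ∧ r.fst = φ ∧ ∃ a ∈ db, a.tag = .cand ∧ a.fst = r.snd

/-- The records to be marked: assumptions whose contrary is near the candidate, and assumptions
from which a rule leads to one that is marked. -/
def ToMark (db : List Record) (v : Fin 4 → Record) : Prop :=
  (v 0).tag = .contr ∧ (NearIn db (v 0).snd ∨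
    ∃ r ∈ db, r.tag = .rule ∧ r.snd = (v 0).fst ∧
      ∃ c ∈ db, c.tag = .contr ∧ c.fst = r.fst ∧ c.mark = true)

/-- The selectors `false` and `true` stand for the first and second field: head and premise of a
rule, assumption and contrary of a pair. -/
noncomputable def nearTest : Test 1 fun db v => NearIn db (v 0).snd :=
  ((((Test.eq 1 false 0 true).exTag 1 .cand).or
    (((Test.eq 1 false 0 true).and ((Test.eq 2 false 1 true).exTag 2 .cand)).exTag 1 .rule) :
      Test 1 _)).congr fun db v => by
    simp [NearIn, Record.field]

noncomputable def markTest : Test 1 ToMark :=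
  ((Test.tag 0 .contr).and (nearTest.or
    (((Test.eq 1 true 0 false).and
      (((Test.eq 2 false 1 false).and (Test.mark 2)).exTag 2 .contr)).exTag 1 .rule))).congr
    fun db v => by
    simp [ToMark, Record.field]

/-- The listing describes a bipolar framework, and its candidate is an admissible extension. -/
structure Good (db : List Record) : Prop where
  nonempty : ∃ c ∈ db, c.tag = .contr
  contr_mem : ∀ c ∈ db, c.tag = .contr →
    (∃ l ∈ db, l.tag = .lang ∧ l.fst = c.fst) ∧ ∃ l ∈ db, l.tag = .lang ∧ l.fst = c.snd
  contr_unique : ∀ c ∈ db, c.tag = .contr → ∀ d ∈ db, d.tag = .contr → d.fst = c.fst → d.snd = c.snd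
  bipolar : ∀ r ∈ db, r.tag = .rule → (∃ c ∈ db, c.tag = .contr ∧ c.fst = r.snd) ∧
    ((∃ c ∈ db, c.tag = .contr ∧ c.fst = r.fst) ∨ ∃ c ∈ db, c.tag = .contr ∧ c.snd = r.fst)
  subset : ∀ a ∈ db, a.tag = .cand → ∃ c ∈ db, c.tag = .contr ∧ c.fst = a.fst
  closed : ∀ r ∈ db, r.tag = .rule → (∃ a ∈ db, a.tag = .cand ∧ a.fst = r.snd) →
    (∃ c ∈ db, c.tag = .contr ∧ c.fst = r.fst) → ∃ a ∈ db, a.tag = .cand ∧ a.fst = r.fst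
  conflictFree : ∀ c ∈ db, c.tag = .contr → (∃ a ∈ db, a.tag = .cand ∧ a.fst = c.fst) →
    ¬ NearIn db c.snd
  -- Marks stand for doom here, so this clause has its intended meaning only once the marking is
  -- complete.
  defends : ∀ c ∈ db, c.tag = .contr → (∃ a ∈ db, a.tag = .cand ∧ a.fst = c.fst) →
    (∀ d ∈ db, d.tag = .contr → d.fst = c.snd → d.mark = true) ∧
      ∀ r ∈ db, r.tag = .rule → r.fst = c.snd →
        ∃ d ∈ db, d.tag = .contr ∧ d.fst = r.snd ∧ d.mark = true

/-- At most three quantifiers are nested, so the four tapes suffice. -/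
noncomputable def goodTest : Test 0 fun db _ => Good db :=
  ((((Test.tag 0 .contr).ex 0 : Test 0 _).and
    ((((Test.eq 1 false 0 false).exTag 1 .lang).and
      ((Test.eq 1 false 0 true).exTag 1 .lang)).allTag 0 .contr)).and
    (((((Test.eq 1 false 0 false).imp (Test.eq 1 true 0 true)).allTag 1 .contr).allTag 0 .contr).and
    (((((Test.eq 1 false 0 true).exTag 1 .contr).and
      (((Test.eq 1 false 0 false).exTag 1 .contr).or
        ((Test.eq 1 true 0 false).exTag 1 .contr))).allTag 0 .rule).and
    ((((Test.eq 1 false 0 false).exTag 1 .contr).allTag 0 .cand).and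
    (((((Test.eq 1 false 0 true).exTag 1 .cand).imp
      (((Test.eq 1 false 0 false).exTag 1 .contr).imp
        ((Test.eq 1 false 0 false).exTag 1 .cand))).allTag 0 .rule).and
    (((((Test.eq 1 false 0 false).exTag 1 .cand).imp nearTest.not).allTag 0 .contr).and
    ((((Test.eq 1 false 0 false).exTag 1 .cand).imp
      ((((Test.eq 1 false 0 true).imp (Test.mark 1)).allTag 1 .contr).and
        (((Test.eq 1 false 0 true).imp
          (((Test.eq 2 false 1 true).and (Test.mark 2)).exTag 2 .contr)).allTag 1
            .rule))).allTag 0 .contr))))))).congr fun db v => by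
    simp only [Record.field, Function.update_self, Bool.false_eq_true, if_false, if_true,
      Function.update_of_ne (show (0 : Fin 4) ≠ 1 by decide),
      Function.update_of_ne (show (1 : Fin 4) ≠ 2 by decide)]
    exact ⟨fun ⟨⟨h₁, h₂⟩, h₃, h₄, h₅, h₆, h₇, h₈⟩ => ⟨h₁, h₂, h₃, h₄, h₅, h₆, h₇, h₈⟩,
      fun ⟨h₁, h₂, h₃, h₄, h₅, h₆, h₇, h₈⟩ => ⟨⟨h₁, h₂⟩, h₃, h₄, h₅, h₆, h₇, h₈⟩⟩

/-! ### Marking -/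

namespace UnaryListing

variable (D : UnaryListing)

/-- The records of a listing, those of the pairs in `m` being marked. -/
def recordsWith (m : Sentence × Sentence → Bool) : List Record :=
  D.lang.map (fun φ => ⟨.lang, false, φ, []⟩) ++
    (D.rules.map (fun p => ⟨.rule, false, p.1, p.2⟩) ++
      (D.contraries.map (fun p => ⟨.contr, m p, p.1, p.2⟩) ++
        D.candidate.map fun φ => ⟨.cand, false, φ, []⟩))

variable {D} {m : Sentence × Sentence → Bool} {p : Record → Prop}

@[simp] theorem exists_lang : (∃ r ∈ D.recordsWith m, r.tag = .lang ∧ p r) ↔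
    ∃ φ ∈ D.lang, p ⟨.lang, false, φ, []⟩ := by
  simp [recordsWith, or_and_right, exists_or]

@[simp] theorem exists_rule : (∃ r ∈ D.recordsWith m, r.tag = .rule ∧ p r) ↔
    ∃ a b, (a, b) ∈ D.rules ∧ p ⟨.rule, false, a, b⟩ := by
  simp [recordsWith, or_and_right, exists_or]

@[simp] theorem exists_contr : (∃ r ∈ D.recordsWith m, r.tag = .contr ∧ p r) ↔
    ∃ a b, (a, b) ∈ D.contraries ∧ p ⟨.contr, m (a, b), a, b⟩ := by
  simp [recordsWith, or_and_right, exists_or]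

@[simp] theorem exists_cand : (∃ r ∈ D.recordsWith m, r.tag = .cand ∧ p r) ↔
    ∃ φ ∈ D.candidate, p ⟨.cand, false, φ, []⟩ := by
  simp [recordsWith, or_and_right, exists_or]

@[simp] theorem forall_rule : (∀ r ∈ D.recordsWith m, r.tag = .rule → p r) ↔
    ∀ a b, (a, b) ∈ D.rules → p ⟨.rule, false, a, b⟩ := by
  have h := not_congr (exists_rule (D := D) (m := m) (p := fun r => ¬ p r))
  push Not at h
  exact h

@[simp] theorem forall_contr : (∀ r ∈ D.recordsWith m, r.tag = .contr → p r) ↔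
    ∀ a b, (a, b) ∈ D.contraries → p ⟨.contr, m (a, b), a, b⟩ := by
  have h := not_congr (exists_contr (D := D) (m := m) (p := fun r => ¬ p r))
  push Not at h
  exact h

@[simp] theorem forall_cand : (∀ r ∈ D.recordsWith m, r.tag = .cand → p r) ↔
    ∀ φ ∈ D.candidate, p ⟨.cand, false, φ, []⟩ := by
  have h := not_congr (exists_cand (D := D) (m := m) (p := fun r => ¬ p r))
  push Not at h
  exact h

variable (D)

/-- The sentence is in the candidate or the head of a rule whose premise is. -/
def Near (φ : Sentence) : Prop :=
  φ ∈ D.candidate ∨ ∃ b, (φ, b) ∈ D.rules ∧ b ∈ D.candidate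

theorem nearIn_recordsWith (φ : Sentence) : NearIn (D.recordsWith m) φ ↔ D.Near φ := by
  simp [NearIn, Near]

open Classical in
/-- One round of marking. -/
noncomputable def markStep (m : Sentence × Sentence → Bool) (p : Sentence × Sentence) : Bool :=
  m p || decide (D.Near p.2 ∨ ∃ a, (a, p.1) ∈ D.rules ∧ ∃ b, (a, b) ∈ D.contraries ∧ m (a, b) = true)

theorem markStep_eq_true {p : Sentence × Sentence} : D.markStep m p = true ↔ m p = true ∨
    D.Near p.2 ∨ ∃ a, (a, p.1) ∈ D.rules ∧ ∃ b, (a, b) ∈ D.contraries ∧ m (a, b) = true := by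
  simp [markStep]

/-- Only records of contraries are ever marked, so the state of the machine between rounds is
captured by a function `m` on pairs, and a round becomes `markStep`. -/
theorem markAll_recordsWith :
    markAll ToMark (D.recordsWith m) = D.recordsWith (D.markStep m) := by
  classical
  have hc : ∀ p : Sentence × Sentence,
      ToMark (D.recordsWith m) (fun _ => ⟨.contr, m p, p.1, p.2⟩) ↔
        D.Near p.2 ∨ ∃ a, (a, p.1) ∈ D.rules ∧ ∃ b, (a, b) ∈ D.contraries ∧ m (a, b) = true := by
    intro p
    simp [ToMark, nearIn_recordsWith]
  have hn : ∀ r : Record, r.tag ≠ .contr → ¬ ToMark (D.recordsWith m) fun _ => r :=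
    fun r hr h => hr h.1
  unfold markAll
  conv_lhs => arg 2; rw [recordsWith]
  conv_rhs => rw [recordsWith]
  simp only [List.map_append, List.map_map]
  congr 1
  · exact List.map_congr_left fun φ _ => if_neg (hn _ (by simp))
  congr 1
  · exact List.map_congr_left fun φ _ => if_neg (hn _ (by simp))
  congr 1
  · refine List.map_congr_left fun p _ => ?_
    simp only [Function.comp_apply, hc]
    by_cases h : D.Near p.2 ∨ ∃ a, (a, p.1) ∈ D.rules ∧ ∃ b, (a, b) ∈ D.contraries ∧ m (a, b) = true
    · rw [if_pos h]
      simp only [markStep, h, decide_true, Bool.or_true]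
      rfl
    · rw [if_neg h]
      simp only [markStep, h, decide_false, Bool.or_false]
  · exact List.map_congr_left fun φ _ => if_neg (hn _ (by simp))

theorem iterate_markAll (n : ℕ) :
    (markAll ToMark)^[n] D.records = D.recordsWith (D.markStep^[n] fun _ => false) := by
  induction n with
  | zero => rfl
  | succ n ih =>
    rw [Function.iterate_succ_apply', Function.iterate_succ_apply', ih, markAll_recordsWith]

/-- The pairs that are marked eventually. -/
inductive Marked : Sentence × Sentence → Prop
  | near {p : Sentence × Sentence} (hp : p ∈ D.contraries) (h : D.Near p.2) : Marked p
  | edge {p : Sentence × Sentence} {a b : Sentence} (hp : p ∈ D.contraries)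
      (hr : (a, p.1) ∈ D.rules) (hm : Marked (a, b)) : Marked p

variable {D}

theorem Marked.mem {p : Sentence × Sentence} (h : D.Marked p) : p ∈ D.contraries := by
  cases h <;> assumption

theorem marked_of_iterate {n : ℕ} {p : Sentence × Sentence} (hp : p ∈ D.contraries)
    (h : D.markStep^[n] (fun _ => false) p = true) : D.Marked p := by
  induction n generalizing p with
  | zero => simp at h
  | succ n ih =>
    rw [Function.iterate_succ_apply', markStep_eq_true] at h
    rcases h with h | h | ⟨a, hr, b, hb, h⟩
    · exact ih hp h
    · exact .near hp h
    · exact .edge hp hr (ih hb h)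

/-- The potential is the number of distinct unmarked pairs: a round either marks a new pair and
lowers it, or leaves a set closed under the clauses of `Marked`, which then contains every marked
pair. -/
theorem complete_or_card (n : ℕ) :
    (∀ p, D.Marked p → D.markStep^[n] (fun _ => false) p = true) ∨
      (D.contraries.toFinset.filter fun p => D.markStep^[n] (fun _ => false) p = false).card + n ≤
        D.contraries.length := by
  induction n with
  | zero =>
    right
    exact (Finset.card_filter_le _ _).trans (List.toFinset_card_le _)
  | succ n ih =>
    set m := D.markStep^[n] fun _ => false with hm
    rw [Function.iterate_succ_apply', ← hm]
    have mono : ∀ p, m p = true → D.markStep m p = true := fun p hp =>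
      D.markStep_eq_true.2 (Or.inl hp)
    rcases ih with ih | ih
    · exact Or.inl fun p hp => mono p (ih p hp)
    -- If the round adds nothing, induction on `Marked` shows that `m` is already complete.
    by_cases hstable : ∀ p ∈ D.contraries, D.markStep m p = true → m p = true
    · refine Or.inl fun p hp => mono p ?_
      induction hp with
      | near hp h => exact hstable _ hp (D.markStep_eq_true.2 (Or.inr (Or.inl h)))
      | @edge p a b hp hr h ih =>
        exact hstable _ hp (D.markStep_eq_true.2 (Or.inr (Or.inr ⟨a, hr, b, h.mem, ih⟩)))
    · right
      push Not at hstable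
      obtain ⟨p, hp, h₁, h₂⟩ := hstable
      have : (D.contraries.toFinset.filter fun p => D.markStep m p = false).card <
          (D.contraries.toFinset.filter fun p => m p = false).card := by
        refine Finset.card_lt_card (Finset.ssubset_iff_of_subset ?_ |>.2 ⟨p, ?_, ?_⟩)
        · intro q hq
          simp only [Finset.mem_filter] at hq ⊢
          refine ⟨hq.1, ?_⟩
          by_contra hqm
          simp [mono q (by simpa using hqm)] at hq
        · simpa [hp] using h₂
        · simp [h₁]
      omega

theorem iterate_eq_true_iff {n : ℕ} (hn : D.contraries.length < n) {p : Sentence × Sentence}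
    (hp : p ∈ D.contraries) : D.markStep^[n] (fun _ => false) p = true ↔ D.Marked p := by
  refine ⟨marked_of_iterate hp, fun h => ?_⟩
  rcases complete_or_card (D := D) n with hc | hc
  · exact hc p h
  -- More rounds than pairs have been made, so the counting alternative is impossible.
  · omega

/-- This justifies the length of the input as number of rounds; the end marker makes the inequality
strict even for an empty list. -/
theorem length_lt_encode : D.contraries.length < D.toListing.encode.length := by
  have : ∀ l : List (Sentence × Sentence), l.length < (encodeList encodePair l).length := by
    intro l
    induction l with
    | nil => simp [encodeList]
    | cons p l ih =>
      have h : encodeList encodePair (p :: l) = encodePair p ++ encodeList encodePair l := by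
        simp [encodeList]
      rw [h]
      simp only [encodePair, encodeSentence, List.length_append, List.length_cons, List.length_map,
        List.length_nil]
      omega
  rw [encode_toListing]
  simp only [List.length_append]
  have := this D.contraries
  omega

end UnaryListing

end ABA


/-! ### Listings, the frameworks they describe, and correctness of the final test -/

namespace ABA

namespace UnaryListing

variable (D : UnaryListing)

/-- The listing describes a bipolar framework. -/
structure Sound : Prop where
  nonempty : ∃ a b, (a, b) ∈ D.contraries
  contr_mem : ∀ a b, (a, b) ∈ D.contraries → a ∈ D.lang ∧ b ∈ D.lang
  contr_unique : ∀ a b, (a, b) ∈ D.contraries → ∀ c, (a, c) ∈ D.contraries → c = b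
  bipolar : ∀ a b, (a, b) ∈ D.rules → (∃ c, (b, c) ∈ D.contraries) ∧
    ((∃ c, (a, c) ∈ D.contraries) ∨ ∃ c, (c, a) ∈ D.contraries)

/-- The candidate is an admissible extension. -/
structure Accepted : Prop where
  subset : ∀ φ ∈ D.candidate, ∃ c, (φ, c) ∈ D.contraries
  closed : ∀ a b, (a, b) ∈ D.rules → b ∈ D.candidate → (∃ c, (a, c) ∈ D.contraries) →
    a ∈ D.candidate
  conflictFree : ∀ a b, (a, b) ∈ D.contraries → a ∈ D.candidate → ¬ D.Near b
  defends : ∀ a b, (a, b) ∈ D.contraries → a ∈ D.candidate →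
    (∀ c, (b, c) ∈ D.contraries → D.Marked (b, c)) ∧
      ∀ c, (b, c) ∈ D.rules → ∃ d, (c, d) ∈ D.contraries ∧ D.Marked (c, d)

/-- Once the marks agree with `Marked` on the listed pairs, the final test separates into a
condition for describing a framework and a condition on the candidate. -/
theorem good_recordsWith_iff {m : Sentence × Sentence → Bool}
    (hm : ∀ p ∈ D.contraries, m p = true ↔ D.Marked p) :
    Good (D.recordsWith m) ↔ D.Sound ∧ D.Accepted := by
  have hm₁ : ∀ b, (∀ a c, (a, c) ∈ D.contraries → a = b → m (a, c) = true) ↔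
      ∀ c, (b, c) ∈ D.contraries → D.Marked (b, c) := fun b =>
    ⟨fun h c hc => (hm _ hc).1 (h b c hc rfl), fun h a c hc e => by
      subst e
      exact (hm _ hc).2 (h c hc)⟩
  have hm₂ : ∀ c, (∃ a d, (a, d) ∈ D.contraries ∧ a = c ∧ m (a, d) = true) ↔
      ∃ d, (c, d) ∈ D.contraries ∧ D.Marked (c, d) := fun c =>
    ⟨fun ⟨a, d, h, e, hmd⟩ => by
      subst e
      exact ⟨d, h, (hm _ h).1 hmd⟩, fun ⟨d, h, hmd⟩ => ⟨c, d, h, rfl, (hm _ h).2 hmd⟩⟩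
  constructor
  · rintro ⟨h₁, h₂, h₃, h₄, h₅, h₆, h₇, h₈⟩
    -- The trivial predicate brings the bare existence of a contrary into the form that
    -- `exists_contr` expects.
    have h₁' := exists_contr (D := D) (m := m) (p := fun _ => True)
    simp only [and_true] at h₁'
    rw [h₁'] at h₁
    simp only [forall_contr, exists_lang, forall_rule, forall_cand, exists_contr, exists_cand,
      nearIn_recordsWith, exists_eq_right, hm₁, hm₂] at h₂ h₃ h₄ h₅ h₆ h₇ h₈
    refine ⟨⟨h₁, h₂, fun a b hab c hac => h₃ a b hab a c hac rfl, fun a b hab => ?_⟩,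
      ⟨fun φ hφ => ?_, fun a b hab hb hc => ?_, h₇, fun a b hab ha => ⟨(h₈ a b hab ha).1, ?_⟩⟩⟩
    · simpa using h₄ a b hab
    · simpa using h₅ φ hφ
    · exact h₆ a b hab hb (by simpa using hc)
    · intro c hc
      exact (h₈ a b hab ha).2 b c hc rfl
  · rintro ⟨⟨h₁, h₂, h₃, h₄⟩, ⟨h₅, h₆, h₇, h₈⟩⟩
    have h₁' := exists_contr (D := D) (m := m) (p := fun _ => True)
    simp only [and_true] at h₁'
    constructor
    · rwa [h₁']
    all_goals simp only [forall_contr, exists_lang, forall_rule, forall_cand, exists_contr,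
      exists_cand, nearIn_recordsWith, exists_eq_right, hm₁, hm₂]
    · exact h₂
    · rintro a b hab a c hac rfl
      exact h₃ _ _ hab _ hac
    · intro a b hab
      simpa using h₄ a b hab
    · intro φ hφ
      simpa using h₅ φ hφ
    · intro a b hab hb hc
      exact h₆ a b hab hb (by simpa using hc)
    · exact h₇
    · rintro a b hab ha
      refine ⟨(h₈ a b hab ha).1, ?_⟩
      rintro _ c hc rfl
      exact (h₈ a _ hab ha).2 c hc

variable {D}

section Describes

variable {F : Framework Sentence} {A : Set Sentence}

theorem edge_iff (h : D.toListing.Describes F A) {a b : Sentence} :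
    F.Edge a b ↔ (b, a) ∈ D.rules := by
  rw [Framework.Edge, ← h.2.1]
  simp [toListing, unaryRule]

theorem mem_assumptions_iff (h : D.toListing.Describes F A) {a : Sentence} :
    a ∈ F.assumptions ↔ ∃ b, (a, b) ∈ D.contraries := by
  constructor
  · intro ha
    exact ⟨_, (h.2.2.1 a _).2 ⟨ha, rfl⟩⟩
  · rintro ⟨b, hb⟩
    exact ((h.2.2.1 a b).1 hb).1

theorem contrary_eq_iff (h : D.toListing.Describes F A) (a : F.assumptions) {φ : Sentence} :
    (a.1, φ) ∈ D.contraries ↔ (F.contrary a : Sentence) = φ :=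
  (h.2.2.1 a φ).trans ⟨fun ⟨_, e⟩ => e, fun e => ⟨a.2, e⟩⟩

theorem near_iff (h : D.toListing.Describes F A) {φ : Sentence} : F.Near A φ ↔ D.Near φ := by
  have hA : ∀ φ, φ ∈ D.candidate ↔ φ ∈ A := h.2.2.2
  simp only [Framework.Near, Near, edge_iff h, hA]
  exact or_congr_right (exists_congr fun _ => and_comm)

/-- A derivation of `Marked` is a path to an assumption whose contrary is near the candidate, built
up from its far end; accordingly the converse adds edges at the front of the path. -/
theorem marked_iff (h : D.toListing.Describes F A) (hF : F.Bipolar) (a : F.assumptions) :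
    D.Marked (a.1, (F.contrary a : Sentence)) ↔ F.Doomed A a := by
  constructor
  · intro hm
    suffices ∀ p, D.Marked p → ∀ ha : p.1 ∈ F.assumptions, F.Doomed A p.1 from this _ hm a.2
    intro p hp
    induction hp with
    | @near p hp hn =>
      intro ha
      refine ⟨⟨p.1, ha⟩, .refl, ?_⟩
      rw [near_iff h, (contrary_eq_iff h ⟨p.1, ha⟩ (φ := p.2)).1 hp]
      exact hn
    | @edge p b c hp hr hm ih =>
      intro ha
      obtain ⟨β, hβ, hn⟩ := ih ((mem_assumptions_iff h).2 ⟨c, hm.mem⟩)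
      exact ⟨β, .head ((edge_iff h).2 hr) hβ, hn⟩
  · rintro ⟨β, hβ, hn⟩
    suffices ∀ x y : Sentence, Relation.ReflTransGen F.Edge x y → y = β →
        ∀ hx : x ∈ F.assumptions, D.Marked (x, (F.contrary ⟨x, hx⟩ : Sentence)) from
      this _ _ hβ rfl a.2
    intro x y hxy hy
    subst hy
    induction hxy using Relation.ReflTransGen.head_induction_on with
    | refl => exact fun hx => .near ((contrary_eq_iff h ⟨_, hx⟩).2 rfl) ((near_iff h).1 hn)
    | @head x y hxy hyb ih =>
      intro hx
      -- An inner vertex is the premise of the next rule; the end of the path is `β`.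
      have hy : y ∈ F.assumptions := by
        rcases hyb.cases_head with rfl | ⟨z, hz, -⟩
        · exact β.2
        · exact hF.mem_of_edge hz
      exact .edge ((contrary_eq_iff h ⟨_, hx⟩).2 rfl) ((edge_iff h).1 hxy) (ih hy)

theorem accepted_iff (h : D.toListing.Describes F A) (hF : F.Bipolar) :
    D.Accepted ↔ F.Admissible A := by
  have hA : ∀ φ, φ ∈ D.candidate ↔ φ ∈ A := h.2.2.2
  have hasm := fun a => mem_assumptions_iff h (a := a)
  -- The contrary map is a function, so the pair with first entry `c`, if any, is the one to which
  -- `marked_iff` applies.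
  have hdoom : ∀ c, (∃ d, (c, d) ∈ D.contraries ∧ D.Marked (c, d)) ↔
      c ∈ F.assumptions ∧ F.Doomed A c := by
    intro c
    constructor
    · rintro ⟨d, hd, hm⟩
      have hc : c ∈ F.assumptions := (hasm c).2 ⟨d, hd⟩
      have e := (contrary_eq_iff h ⟨c, hc⟩).1 hd
      subst e
      exact ⟨hc, (marked_iff h hF ⟨c, hc⟩).1 hm⟩
    · rintro ⟨hc, hd⟩
      exact ⟨_, (contrary_eq_iff h ⟨c, hc⟩).2 rfl, (marked_iff h hF ⟨c, hc⟩).2 hd⟩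
  rw [hF.admissible_iff]
  constructor
  · rintro ⟨h₁, h₂, h₃, h₄⟩
    refine ⟨fun φ hφ => (hasm φ).2 (h₁ φ ((hA φ).2 hφ)), fun a ha b hb hab =>
      (hA b).1 (h₂ b a ((edge_iff h).1 hab) ((hA a).2 ha) ((hasm b).1 hb)), fun α hα =>
      (near_iff h).not.2 (h₃ α _ ((contrary_eq_iff h α).2 rfl) ((hA α).2 hα)), fun α hα => ?_⟩
    obtain ⟨h₅, h₆⟩ := h₄ α _ ((contrary_eq_iff h α).2 rfl) ((hA α).2 hα)
    refine ⟨fun hc => ?_, fun c hc => ((hdoom c).1 (h₆ c ((edge_iff h).1 hc))).2⟩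
    obtain ⟨d, hd⟩ := (hasm _).1 hc
    exact ((hdoom _).1 ⟨d, hd, h₅ d hd⟩).2
  · rintro ⟨h₁, h₂, h₃, h₄⟩
    refine ⟨fun φ hφ => (hasm φ).1 (h₁ ((hA φ).1 hφ)), fun a b hab hb hc =>
      (hA a).2 (h₂ b ((hA b).1 hb) a ((hasm a).2 hc) ((edge_iff h).2 hab)), fun a b hab ha => ?_,
      fun a b hab ha => ?_⟩
    · have haF := (hasm a).2 ⟨b, hab⟩
      have e := (contrary_eq_iff h ⟨a, haF⟩).1 hab
      subst e
      exact (near_iff h).not.1 (h₃ ⟨a, haF⟩ ((hA a).1 ha))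
    · have haF := (hasm a).2 ⟨b, hab⟩
      have e := (contrary_eq_iff h ⟨a, haF⟩).1 hab
      subst e
      obtain ⟨h₅, h₆⟩ := h₄ ⟨a, haF⟩ ((hA a).1 ha)
      refine ⟨fun c hc => ?_, fun c hc => ?_⟩
      · have hcF := (hasm _).2 ⟨c, hc⟩
        have e := (contrary_eq_iff h ⟨_, hcF⟩).1 hc
        subst e
        exact (marked_iff h hF ⟨_, hcF⟩).2 (h₅ hcF)
      · have hcF := (edge_iff h).2 hc
        exact (hdoom c).2 ⟨hF.mem_of_edge hcF, h₆ c hcF⟩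

/-- Together with `describes_framework` and `bipolar_framework`, this makes `Sound` the exact
condition for a unary listing to come from a bipolar framework. -/
theorem sound_of_describes (h : D.toListing.Describes F A) (hF : F.Bipolar) : D.Sound := by
  have hL : ∀ φ, φ ∈ D.lang ↔ φ ∈ F.lang := h.1
  refine ⟨?_, fun a b hab => ?_, fun a b hab c hac => ?_, fun a b hab => ?_⟩
  · obtain ⟨a, ha⟩ := F.assumptions_nonempty
    obtain ⟨b, hb⟩ := (mem_assumptions_iff h).1 ha
    exact ⟨a, b, hb⟩
  · have ha := (mem_assumptions_iff h).2 ⟨b, hab⟩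
    rw [hL, hL, ← (contrary_eq_iff h ⟨a, ha⟩).1 hab]
    exact ⟨F.assumptions_subset ha, (F.contrary ⟨a, ha⟩).2⟩
  · have ha := (mem_assumptions_iff h).2 ⟨b, hab⟩
    rw [← (contrary_eq_iff h ⟨a, ha⟩).1 hab, ← (contrary_eq_iff h ⟨a, ha⟩).1 hac]
  · have he := (edge_iff h).2 hab
    refine ⟨(mem_assumptions_iff h).1 (hF.mem_of_edge he), ?_⟩
    obtain ⟨-, -, -, hh⟩ := hF _ he
    rcases hh with hh | ⟨β, hβ⟩
    · exact Or.inl ((mem_assumptions_iff h).1 hh)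
    · exact Or.inr ⟨β, (contrary_eq_iff h β).2 hβ.symm⟩

end Describes

/-- The framework described by a listing. -/
noncomputable def framework (h : D.Sound) : Framework Sentence where
  lang := {φ | φ ∈ D.lang}
  rules := {r | r ∈ D.toListing.rules}
  head_mem r hr := by
    obtain ⟨⟨a, b⟩, hab, rfl⟩ := List.mem_map.1 hr
    rcases (h.bipolar a b hab).2 with ⟨c, hc⟩ | ⟨c, hc⟩
    · exact (h.contr_mem _ _ hc).1
    · exact (h.contr_mem _ _ hc).2
  body_mem r hr φ hφ := by
    obtain ⟨⟨a, b⟩, hab, rfl⟩ := List.mem_map.1 hr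
    obtain rfl : φ = b := by simpa [unaryRule] using hφ
    obtain ⟨c, hc⟩ := (h.bipolar _ _ hab).1
    exact (h.contr_mem _ _ hc).1
  assumptions := {a | ∃ b, (a, b) ∈ D.contraries}
  assumptions_subset := fun a ⟨b, hab⟩ => (h.contr_mem a b hab).1
  assumptions_nonempty := h.nonempty
  -- Choice is harmless: `contr_unique` leaves only one possible value, as `describes_framework`
  -- uses.
  contrary a := ⟨a.2.choose, (h.contr_mem _ _ a.2.choose_spec).2⟩

theorem describes_framework (h : D.Sound) :
    D.toListing.Describes (framework h) {φ | φ ∈ D.candidate} := by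
  refine ⟨fun _ => Iff.rfl, fun _ => Iff.rfl, fun a b => ?_, fun _ => Iff.rfl⟩
  constructor
  · intro hab
    have ha : ∃ b, (a, b) ∈ D.contraries := ⟨b, hab⟩
    exact ⟨ha, h.contr_unique a b hab _ ha.choose_spec⟩
  · rintro ⟨ha, rfl⟩
    exact Exists.choose_spec ha

theorem bipolar_framework (h : D.Sound) : (framework h).Bipolar := by
  intro r hr
  obtain ⟨⟨a, b⟩, hab, rfl⟩ := List.mem_map.1 hr
  refine ⟨b, (h.bipolar a b hab).1, rfl, ?_⟩
  rcases (h.bipolar a b hab).2 with hc | ⟨c, hc⟩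
  · exact Or.inl hc
  · have hc' : c ∈ (framework h).assumptions := ⟨a, hc⟩
    exact Or.inr ⟨⟨c, hc'⟩, ((contrary_eq_iff (describes_framework h) ⟨c, hc'⟩).1 hc).symm⟩

theorem exists_of_describes {E : Listing} {F : Framework Sentence} {A : Set Sentence}
    (h : E.Describes F A) (hF : F.Bipolar) : ∃ D : UnaryListing, D.toListing = E := by
  -- The default of `headI` is never reached, as each body is a singleton by bipolarity.
  refine ⟨⟨E.lang, E.rules.map fun r => (r.head, r.body.headI), E.contraries, E.candidate⟩, ?_⟩
  have : (E.rules.map fun r => (r.head, r.body.headI)).map unaryRule = E.rules := by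
    rw [List.map_map]
    refine (List.map_congr_left fun r hr => ?_).trans (List.map_id _)
    obtain ⟨α, -, hb, -⟩ := hF r ((h.2.1 r).1 hr)
    rcases r with ⟨a, body⟩
    change body = [α] at hb
    subst hb
    rfl
  simp only [toListing, this]

end UnaryListing

/-- Admissibility is invariant under the choice of describing framework, since `accepted_iff`
expresses it through the listing alone; for the converse the framework built from the listing serves
as witness. -/
theorem mem_verAdm_iff (w : List Letter) : w ∈ verAdm ↔ ∃ D : UnaryListing,
    w = D.toListing.encode ∧ Good ((markAll ToMark)^[w.length] D.records) := by
  have key : ∀ D : UnaryListing, Good ((markAll ToMark)^[D.toListing.encode.length] D.records) ↔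
      D.Sound ∧ D.Accepted := fun D => by
    rw [D.iterate_markAll]
    exact D.good_recordsWith_iff fun p hp =>
      UnaryListing.iterate_eq_true_iff UnaryListing.length_lt_encode hp
  constructor
  · rintro ⟨E, F, A, rfl, h, hF, -, hadm⟩
    obtain ⟨D, rfl⟩ := UnaryListing.exists_of_describes h hF
    exact ⟨D, rfl, (key D).2 ⟨UnaryListing.sound_of_describes h hF,
      (UnaryListing.accepted_iff h hF).2 hadm⟩⟩
  · rintro ⟨D, rfl, hgood⟩
    obtain ⟨hs, ha⟩ := (key D).1 hgood
    have h := UnaryListing.describes_framework hs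
    have hadm := (UnaryListing.accepted_iff h (UnaryListing.bipolar_framework hs)).1 ha
    exact ⟨_, _, _, rfl, h, UnaryListing.bipolar_framework hs, hadm.1, hadm⟩

end ABA

theorem mainTheorem6 : InP ABA.verAdm := by
  -- The record supplied is a dummy value, as `goodTest` has no free variables.
  exact ABA.inP_of_tests ABA.markTest ABA.goodTest (fun _ => ⟨.lang, false, [], []⟩)
    ABA.mem_verAdm_iff
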